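/- **Setting.** There are a coordinator and $k\ge 1$ players. Items arrive one by one; independently of the others, each item arrives at player $i$ with probability $\mu_i$, where $\mu_i\ge 0$ and $\sum_{i=1}^k\mu_i=1$ (the $\mu_i$ are known). The coordinator has to raise an alarm exactly at the arrival of the $N$-th item. The communication cost is the number of messages sent and received by the coordinator. **The algorithm DynSlk-KwnDst** with parameter $\delta\in(0,1)$ runs in rounds. Each round starts with the remaining threshold $N$ and with all counters $n_i=0$; $n_i$ counts the items that arrive at player $i$ in the round. 1. If $N\le 4k$, run the straightforward algorithm (the coordinator sends one message to each player, and every item is then reported to it) until the alarm at the $N$-th item. 2. Otherwise, if $N\le \beta k\ln\frac k\delta$ with $\beta=2(\sqrt2+\frac23)^2$, switch for good to the algorithm CMY. It too runs in rounds: if $N<4k$ it runs the straightforward algorithm; otherwise the coordinator sends $s=\lfloor\frac N{2k}\rfloor$ to each player, and a player sends a notification for every increase of its counter by $s$. 3. Otherwise let $t=N-(\sqrt2+\frac23)\sqrt{kN\ln\frac k\delta}$. The coordinator sends to player $i$ the pair $(b_i,s)$ with $b_i=\mu_i t$ and $s=\lfloor\frac{N-t}{2k}\rfloor$. Player $i$,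 once $n_i\ge b_i$, sends a notification for every further increase of $n_i$ by $s$, that is, whenever $n_i=\lceil b_i\rceil+js$ with $j\ge1$. In the rounds of the last two kinds, at the $k$-th notification ($k$-Notifications-to-End) the coordinator collects all counters (with $k$ requests and $k$ answers) and replaces $N$ by $N-\sum_i n_i$. If the result is $0$ it raises the alarm; otherwise the next round starts (of CMY, after a switch to CMY). **Theorem.** Write $\operatorname{LL}(y)=\log^+\log^+ y$, where $\log^+y=\max(0,\log y)$ for $y>0$ and $\log^+0=0$. There is an absolute constant $C>0$ such that for all $k$, $N$, $(\mu_i)$ and $\delta\in(0,1)$, with probability at least $1-\delta'$, where $\delta'=C\,\delta\,\operatorname{LL}(N)$, DynSlk-KwnDst with threshold $N$ raises the alarm exactly at the arrival of the $N$-th item, and until then - it runs at most $C\left(1+\operatorname{LL}\!\left(\frac{N}{k\log\frac k\delta}\right)+\operatorname{LL}\!\left(\frac k\delta\right)\right)$ rounds; - its total communication cost is at most $C\,k\left(1+\operatorname{LL}\!\left(\frac{N}{k\log\frac k\delta}\right)+\operatorname{LL}\!\left(\frac k\delta\right)\right)$ messages. That is, the bounds are $O(\log\log\frac{N}{k\log(k/\delta)}+\log\log\frac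 k\delta)$ rounds and $O(k\log\log\frac{N}{k\log(k/\delta)}+k\log\log\frac k\delta)$ communication, with failure probability $\delta'=\delta\cdot O(\log\log N)$. -/

import Mathlib

namespace DistributedTracking

/-- The characteristics of an `ℓ`-Notifications-to-End algorithm for `k` players: the slack that
the coordinator sends to player `i` in a round with threshold `N`, the condition under which a
player with a given slack sends a notification when its counter has just become `n`, and the number
`ℓ` of notifications that ends a round. -/
structure Characteristics (k : ℕ) where
  Slack : Type
  slack : ℕ → Fin k → Slack
  notifies : Slack → ℕ → Prop
  ell : ℕ

/-- The (simplified) CMY algorithm: slack `⌊N / (2k)⌋`, a notification for every increase of the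
counter by the slack, and `ℓ = k`. -/
def cmy (k : ℕ) : Characteristics k where
  Slack := ℕ
  slack := fun N _ => N / (2 * k)
  notifies := fun s n => s ∣ n
  ell := k

/-- The number `t = N - (√2 + 2/3) √(k N ln (k/δ))` of items that a round aims to track. -/
noncomputable def target (k : ℕ) (δ : ℝ) (N : ℕ) : ℝ :=
  N - (√2 + 2 / 3) * √(k * N * Real.log (k / δ))

/-- DynSlk-KwnDst: the slack is the pair of the base `b = μ i * t` and the tolerance
`s = ⌊(N - t) / (2k)⌋`; once the counter `n` has reached `b` (that is, at `n = ⌈b⌉`), the player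
notifies for every further increase of the counter by `s`; and `ℓ = k`. -/
noncomputable def dynSlk (k : ℕ) (δ : ℝ) (μ : Fin k → ℝ) : Characteristics k where
  Slack := ℝ × ℕ
  slack := fun N i => (μ i * target k δ N, ⌊(N - target k δ N) / (2 * k)⌋₊)
  notifies := fun bs n => ∃ j : ℕ, 1 ≤ j ∧ n = ⌈bs.1⌉₊ + j * bs.2
  ell := k

/-- What the coordinator and the players are currently executing. -/
inductive Mode
  /-- every item is reported to the coordinator -/
  | straightforward
  /-- a slack round of CMY, to which the algorithm has switched for good -/
  | cmy
  /-- a slack round of the algorithm that is plugged into the framework -/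
  | custom
  /-- the alarm has been raised and the algorithm has terminated -/
  | alarm

/-- The global state of an execution with `k` players. -/
structure State (k : ℕ) where
  mode : Mode
  /-- the threshold of the current round -/
  thr : ℕ
  /-- the counters of the players in the current round -/
  cnt : Fin k → ℕ
  /-- the number of notifications that the coordinator received in the current round -/
  notes : ℕ
  /-- the number of rounds started so far -/
  rounds : ℕ
  /-- the number of messages sent and received by the coordinator so far -/
  msgs : ℕ

/-- The end of one round and the start of the next with threshold `N`, after `r` rounds and `m`
messages. If `N = 0` the alarm is raised. Otherwise the coordinator sends one message to each
player (the slack, or the order to report every item). -/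
def startRound {k : ℕ} (mode : Mode) (N r m : ℕ) : State k :=
  if N = 0 then ⟨.alarm, 0, fun _ => 0, 0, r, m⟩
  else ⟨mode, N, fun _ => 0, 0, r + 1, m + k⟩

/-- A round of CMY with threshold `N`. -/
def startCMY {k : ℕ} (N r m : ℕ) : State k :=
  startRound (if N < 4 * k then .straightforward else .cmy) N r m

open Classical in
/-- A round of the framework with threshold `N`: the straightforward algorithm if `N ≤ 4k`, else
CMY if `N ≤ β k ln (k/δ)`, else a slack round of the plugged-in algorithm. -/
noncomputable def startFramework {k : ℕ} (β δ : ℝ) (N r m : ℕ) : State k :=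
  if N ≤ 4 * k then startRound .straightforward N r m
  else if (N : ℝ) ≤ β * k * Real.log (k / δ) then startCMY N r m
  else startRound .custom N r m

open Classical in
/-- An item arrives at player `i` in a slack round with characteristics `A`. The `ℓ`-th
notification makes the coordinator collect all counters (`k` requests and `k` answers) and go on
with the remaining threshold as prescribed by `next`. -/
noncomputable def slackStep {k : ℕ} (A : Characteristics k) (next : ℕ → ℕ → ℕ → State k)
    (st : State k) (i : Fin k) : State k :=
  let n := Function.update st.cnt i (st.cnt i + 1)
  if A.notifies (A.slack st.thr i) (n i) then
    if st.notes + 1 = A.ell then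
      next (st.thr - ∑ j, n j) st.rounds (st.msgs + 1 + 2 * k)
    else { st with cnt := n, notes := st.notes + 1, msgs := st.msgs + 1 }
  else { st with cnt := n }

/-- An item arrives at player `i` while the straightforward algorithm is executed. -/
def straightStep {k : ℕ} (st : State k) (i : Fin k) : State k :=
  { st with
    mode := if st.notes + 1 = st.thr then .alarm else .straightforward
    cnt := Function.update st.cnt i (st.cnt i + 1)
    notes := st.notes + 1
    msgs := st.msgs + 1 }

/-- The effect of the arrival of one item at player `i`. -/
noncomputable def step {k : ℕ} (A : Characteristics k) (β δ : ℝ) (st : State k) (i : Fin k) :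
    State k :=
  match st.mode with
  | .alarm => st
  | .straightforward => straightStep st i
  | .cmy => slackStep (cmy k) startCMY st i
  | .custom => slackStep A (startFramework β δ) st i

/-- The state of the `ℓ`-Notifications-to-End algorithm with characteristics `A` and threshold `N`
after the arrival of the first `m` items, where `x j` is the player at which item `j` arrives. -/
noncomputable def run {k : ℕ} (A : Characteristics k) (β δ : ℝ) (N : ℕ) (x : ℕ → Fin k) :
    ℕ → State k
  | 0 => startFramework β δ N 0 0
  | m + 1 => step A β δ (run A β δ N x m) (x m)

/-- The execution of DynSlk-KwnDst, with the constant `β = 2 (√2 + 2/3)²`. -/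
noncomputable def dynSlkRun {k : ℕ} (N : ℕ) (δ : ℝ) (μ : Fin k → ℝ) (x : ℕ → Fin k) (m : ℕ) :
    State k :=
  run (dynSlk k δ μ) (2 * (√2 + 2 / 3) ^ 2) δ N x m

/-- The iterated logarithm `log log y`, read as `0` where it is negative or undefined. -/
noncomputable def loglog (y : ℝ) : ℝ := Real.posLog (Real.posLog y)

end DistributedTracking

/-! Write L = log(k/δ), t = `target`, and `scale` = √(k n L) for a round with threshold n.
Deterministic half: fewer than k notifications force fewer than n items (`cmy_sum_lt`,
`dynSlk_sum_lt`), so no round overshoots. A round costs at most 5k messages, hence only the number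
of rounds matters. While n = O(kL), each finished round removes a fixed fraction of n
(`cmy_progress`, `dynSlk_progress`). For larger n, a round in which nobody notifies during about the
first t - 2·`scale` items leaves n' with n'² ≤ 17 k L n (`remaining_sq_le`), so n / (17kL) shrinks
at least to its square root. In both cases `potential` drops by one, and it is O(1 + LL(n/(kL)) +
LL(k/δ)); `runInv` carries this through the execution. Probabilistic half: by a Chernoff bound, a
fixed round has an early notification with probability at most δ (`overfull_prob`). Rounds start at
random times, but a round that starts at time τ has threshold N - τ. So its start depends only on
the first τ items, and an early notification only on later ones. Summing over τ therefore costs δ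
times the expected number of rounds considered (`failure_prob`). Only fast rounds need luck, so the
failure probability has no LL(k/δ) term. -/

namespace DistributedTracking

/-! ### Counting the notifications of one player. -/

open Classical in
/-- The number of `j` with `1 ≤ j ≤ n` that satisfy `p`. -/
noncomputable def notifyCount (p : ℕ → Prop) : ℕ → ℕ
  | 0 => 0
  | n + 1 => notifyCount p n + if p (n + 1) then 1 else 0

lemma notifyCount_mono (p : ℕ → Prop) : Monotone (notifyCount p) :=
  monotone_nat_of_le_succ fun n => by simp [notifyCount]

lemma notifyCount_pos {p : ℕ → Prop} {m n : ℕ} (hm : 1 ≤ m) (hmn : m ≤ n) (hp : p m) :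
    1 ≤ notifyCount p n := by
  refine le_trans ?_ (notifyCount_mono p hmn)
  obtain ⟨m, rfl⟩ := Nat.exists_eq_add_of_le' hm
  simp [notifyCount, hp]

lemma notifyCount_eq_zero {p : ℕ → Prop} {n : ℕ} (h : ∀ m ≤ n, ¬ p m) :
    notifyCount p n = 0 := by
  induction n with
  | zero => rfl
  | succ n ih => simp [notifyCount, ih fun m hm => h m (by omega), h (n + 1) le_rfl]

lemma notifyCount_dvd (s n : ℕ) : notifyCount (fun n => s ∣ n) n = n / s := by
  induction n with
  | zero => simp [notifyCount]
  | succ n ih => simp [notifyCount, ih, Nat.succ_div]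

lemma notifyCount_shift {c s : ℕ} (hs : 1 ≤ s) (n : ℕ) :
    notifyCount (fun n => ∃ j : ℕ, 1 ≤ j ∧ n = c + j * s) n = (n - c) / s := by
  induction n with
  | zero => simp [notifyCount]
  | succ n ih =>
    rw [notifyCount, ih]
    rcases Nat.lt_or_ge n c with h | h
    · have hno : ¬ ∃ j : ℕ, 1 ≤ j ∧ n + 1 = c + j * s := by
        rintro ⟨j, hj, hn⟩
        have := Nat.mul_le_mul hj hs
        omega
      rw [if_neg hno, Nat.sub_eq_zero_of_le h.le, Nat.sub_eq_zero_of_le h, add_zero]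
    · rw [Nat.succ_sub h, Nat.succ_div]
      have hiff : (∃ j : ℕ, 1 ≤ j ∧ n + 1 = c + j * s) ↔ s ∣ n - c + 1 := by
        constructor
        · rintro ⟨j, hj, hn⟩
          exact ⟨j, by rw [Nat.mul_comm s j]; omega⟩
        · rintro ⟨j, hj⟩
          refine ⟨j, ?_, ?_⟩
          · rcases Nat.eq_zero_or_pos j with rfl | h
            · simp at hj
            · exact h
          · rw [Nat.mul_comm] at hj; omega
      simp only [hiff]

/-! ### Sizes of the target, the tolerance and the scale. -/

/-- The tolerance that DynSlk-KwnDst uses in a round with threshold `n`. -/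
noncomputable def tolerance (k : ℕ) (δ : ℝ) (n : ℕ) : ℕ := ⌊(n - target k δ n) / (2 * k)⌋₊

/-- The scale `√(k n log (k/δ))` of the deviations in a round with threshold `n`. -/
noncomputable def scale (k : ℕ) (δ : ℝ) (n : ℕ) : ℝ := √(k * n * Real.log (k / δ))

lemma gamma_bounds : 2 ≤ √2 + 2 / 3 ∧ √2 + 2 / 3 ≤ 21 / 10 := by
  have h1 : (4 / 3 : ℝ) ≤ √2 := Real.le_sqrt_of_sq_le (by norm_num)
  have h2 : √2 ≤ (143 / 100 : ℝ) := Real.sqrt_le_iff.2 (by norm_num)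
  constructor <;> linarith

lemma sub_target (k : ℕ) (δ : ℝ) (n : ℕ) :
    n - target k δ n = (√2 + 2 / 3) * scale k δ n := by
  simp [target, scale]

lemma log_pos {k : ℕ} {δ : ℝ} (hk : 1 ≤ k) (h0 : 0 < δ) (h1 : δ < 1) :
    0 < Real.log (k / δ) := by
  apply Real.log_pos
  rw [one_lt_div h0]
  have : (1 : ℝ) ≤ k := by exact_mod_cast hk
  linarith

/-- For k = 1 there is no such bound, since δ may be close to 1. The tolerance can then be 0, which
is why one player is treated separately below. -/
lemma log_ge {k : ℕ} {δ : ℝ} (hk : 2 ≤ k) (h0 : 0 < δ) (h1 : δ < 1) :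
    1 / 2 ≤ Real.log (k / δ) := by
  have h2 : (2 : ℝ) ≤ k := by exact_mod_cast hk
  have : Real.log 2 ≤ Real.log (k / δ) := by
    apply Real.log_le_log (by norm_num)
    rw [le_div_iff₀ h0]
    nlinarith
  linarith [Real.log_two_gt_d9]

/-- A round of the plugged-in algorithm is run with threshold `n`. -/
structure CustomThreshold (k : ℕ) (δ : ℝ) (n : ℕ) : Prop where
  hk : 1 ≤ k
  δ_pos : 0 < δ
  δ_lt : δ < 1
  four_lt : 4 * k < n
  beta_lt : 2 * (√2 + 2 / 3) ^ 2 * k * Real.log (k / δ) < n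

namespace CustomThreshold
variable {k : ℕ} {δ : ℝ} {n : ℕ}

lemma scale_sq (h : CustomThreshold k δ n) : scale k δ n ^ 2 = k * n * Real.log (k / δ) :=
  Real.sq_sqrt (by have := (log_pos h.hk h.δ_pos h.δ_lt).le; positivity)

lemma n_pos (h : CustomThreshold k δ n) : (0 : ℝ) < n := by
  have := h.four_lt; exact_mod_cast (by omega)

lemma k_ge_one (h : CustomThreshold k δ n) : (1 : ℝ) ≤ k := by exact_mod_cast h.hk

lemma scale_pos (h : CustomThreshold k δ n) : 0 < scale k δ n :=
  Real.sqrt_pos.2 (by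
    have := (log_pos h.hk h.δ_pos h.δ_lt); have := h.n_pos; have := h.k_ge_one; positivity)

lemma two_mul_gamma_sq_scale (h : CustomThreshold k δ n) :
    2 * ((√2 + 2 / 3) * scale k δ n) ^ 2 < n ^ 2 := by
  have h1 := h.scale_sq
  have h2 := mul_lt_mul_of_pos_right h.beta_lt h.n_pos
  calc 2 * ((√2 + 2 / 3) * scale k δ n) ^ 2
      = 2 * (√2 + 2 / 3) ^ 2 * (scale k δ n ^ 2) := by ring
    _ = 2 * (√2 + 2 / 3) ^ 2 * k * Real.log (k / δ) * n := by rw [h1]; ring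
    _ < n ^ 2 := by rw [sq (n : ℝ)]; exact h2

/-- This is the purpose of β = 2(√2 + 2/3)²: above β k L one has n - t < n/√2 < 3n/4, so the target
is positive. -/
lemma gamma_scale_le (h : CustomThreshold k δ n) : (√2 + 2 / 3) * scale k δ n ≤ 3 / 4 * n := by
  have h1 := h.two_mul_gamma_sq_scale
  have := h.n_pos
  apply le_of_sq_le_sq _ (by positivity)
  nlinarith

lemma target_pos (h : CustomThreshold k δ n) : 0 < target k δ n := by
  have h1 := sub_target k δ n
  have := h.gamma_scale_le
  have := h.n_pos
  linarith

lemma target_lt (h : CustomThreshold k δ n) : target k δ n < n := by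
  have h1 := sub_target k δ n
  have h2 := h.scale_pos
  have := mul_pos (lt_of_lt_of_le two_pos gamma_bounds.1) h2
  linarith

lemma scale_ge (h : CustomThreshold k δ n) (hk : 2 ≤ k) : (k : ℝ) ≤ scale k δ n := by
  apply Real.le_sqrt_of_sq_le
  have h1 := log_ge hk h.δ_pos h.δ_lt
  have h2 : (4 * k : ℝ) ≤ n := by exact_mod_cast h.four_lt.le
  have h3 := h.k_ge_one
  have : (k : ℝ) * (4 * k) * (1 / 2) ≤ k * n * Real.log (k / δ) := by gcongr
  nlinarith

/-- The number y inside the floor is at least 1, so rounding down at most halves it; the factor √2 +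
2/3 ≥ 2 compensates. -/
lemma scale_le_tolerance (h : CustomThreshold k δ n) (hk : 2 ≤ k) :
    scale k δ n ≤ 2 * k * tolerance k δ n := by
  have h3 := h.k_ge_one
  have h1 := h.scale_ge hk
  have h0 := gamma_bounds.1
  set y := (n - target k δ n) / (2 * k) with hy
  have hy' : y * (2 * k) = (√2 + 2 / 3) * scale k δ n := by
    rw [hy, sub_target]; field_simp
  have h5 : 2 * scale k δ n ≤ y * (2 * k) := by rw [hy']; gcongr; linarith
  have hy1 : 1 ≤ y := by
    by_contra hc
    nlinarith
  have h4 : y < ⌊y⌋₊ + 1 := Nat.lt_floor_add_one y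
  have h6 : (1 : ℝ) ≤ ⌊y⌋₊ := by exact_mod_cast (Nat.one_le_floor_iff y).2 hy1
  have h7 : tolerance k δ n = ⌊y⌋₊ := rfl
  rw [h7]
  nlinarith

lemma tolerance_pos (h : CustomThreshold k δ n) (hk : 2 ≤ k) : 1 ≤ tolerance k δ n := by
  by_contra hc
  have h0 : tolerance k δ n = 0 := by omega
  have h1 := h.scale_le_tolerance hk
  have h2 := h.scale_pos
  rw [h0] at h1
  simp at h1
  linarith

lemma mul_tolerance_le (h : CustomThreshold k δ n) :
    2 * k * (tolerance k δ n : ℝ) ≤ n - target k δ n := by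
  have h3 := h.k_ge_one
  have h1 : (tolerance k δ n : ℝ) ≤ (n - target k δ n) / (2 * k) := by
    apply Nat.floor_le
    have := h.target_lt
    apply div_nonneg <;> linarith
  rw [le_div_iff₀ (by linarith)] at h1
  linarith

end CustomThreshold

/-! ### Safety and progress of a single round. -/

section Rounds
variable {k : ℕ}

/-- A player with q notifications has fewer than s(q + 1) items. The sum of the q + 1 is at most 2k
- 1, and 2ks ≤ n. -/
lemma cmy_sum_lt {n : ℕ} (hk : 1 ≤ k) (hn : 4 * k ≤ n) (c : Fin k → ℕ)
    (hc : ∑ i, notifyCount ((cmy k).notifies ((cmy k).slack n i)) (c i) < k) :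
    ∑ i, c i < n := by
  set s := n / (2 * k) with hs
  have h2 : 2 ≤ s := by rw [hs, Nat.le_div_iff_mul_le (by omega)]; omega
  have hc' : ∑ i, c i / s < k := by
    simpa only [cmy, notifyCount_dvd] using hc
  have h1 : ∑ i, c i ≤ ∑ i : Fin k, (s * (c i / s) + s) :=
    Finset.sum_le_sum fun i _ => by
      have := Nat.div_add_mod (c i) s
      have := Nat.mod_lt (c i) (show s > 0 by omega)
      omega
  rw [Finset.sum_add_distrib, ← Finset.mul_sum] at h1
  simp only [Finset.sum_const, Finset.card_univ, Fintype.card_fin, smul_eq_mul] at h1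
  have h3 : s * (2 * k) ≤ n := Nat.div_mul_le_self _ _
  nlinarith

/-- The k notifications account for ks items, and s ≥ 2 gives n < 2k(s + 1) ≤ 3ks. -/
lemma cmy_progress {n : ℕ} (hk : 1 ≤ k) (hn : 4 * k ≤ n) (c : Fin k → ℕ)
    (hc : ∑ i, notifyCount ((cmy k).notifies ((cmy k).slack n i)) (c i) = k) :
    n ≤ 4 * ∑ i, c i := by
  set s := n / (2 * k) with hs
  have h2 : 2 ≤ s := by rw [hs, Nat.le_div_iff_mul_le (by omega)]; omega
  have hc' : ∑ i, c i / s = k := by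
    simpa only [cmy, notifyCount_dvd] using hc
  have h1 : ∑ i : Fin k, s * (c i / s) ≤ ∑ i, c i :=
    Finset.sum_le_sum fun i _ => Nat.mul_div_le _ _
  rw [← Finset.mul_sum, hc'] at h1
  have h3 : n < 2 * k * (s + 1) := Nat.lt_mul_div_succ n (by omega)
  nlinarith

variable {δ : ℝ} {μ : Fin k → ℝ} {n : ℕ}

lemma dynSlk_silent (c : Fin k → ℕ)
    (hc : ∀ i, c i < ⌈μ i * target k δ n⌉₊ + tolerance k δ n) :
    ∑ i, notifyCount ((dynSlk k δ μ).notifies ((dynSlk k δ μ).slack n i)) (c i) = 0 := by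
  refine Finset.sum_eq_zero fun i _ => notifyCount_eq_zero ?_
  rintro m hm ⟨j, hj, rfl⟩
  have h1 : ⌈μ i * target k δ n⌉₊ + j * tolerance k δ n ≤ c i := hm
  have := Nat.mul_le_mul_right (tolerance k δ n) hj
  have := hc i
  omega

lemma dynSlk_notifies_at (i : Fin k) {m : ℕ}
    (hm : 1 ≤ ⌈μ i * target k δ n⌉₊ + tolerance k δ n)
    (h : ⌈μ i * target k δ n⌉₊ + tolerance k δ n ≤ m) :
    1 ≤ notifyCount ((dynSlk k δ μ).notifies ((dynSlk k δ μ).slack n i)) m :=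
  notifyCount_pos hm h ⟨1, le_rfl, by simp [dynSlk, tolerance]⟩

lemma dynSlk_notifyCount (hs : 1 ≤ tolerance k δ n) (i : Fin k) (m : ℕ) :
    notifyCount ((dynSlk k δ μ).notifies ((dynSlk k δ μ).slack n i)) m =
      (m - ⌈μ i * target k δ n⌉₊) / tolerance k δ n :=
  notifyCount_shift hs m

/-- A player with q notifications exceeds its base μᵢt by less than s(q + 1), and the bases sum to
t. The total is thus at most t + (2k - 1)s < t + 2ks ≤ n. -/
lemma dynSlk_sum_lt (h : CustomThreshold k δ n) (h0 : ∀ i, 0 ≤ μ i) (h1 : ∑ i, μ i = 1)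
    (c : Fin k → ℕ)
    (hc : ∑ i, notifyCount ((dynSlk k δ μ).notifies ((dynSlk k δ μ).slack n i)) (c i) < k) :
    ∑ i, c i < n := by
  have ht := h.target_pos
  have hs := h.mul_tolerance_le
  have hk1 := h.k_ge_one
  rcases Nat.lt_or_ge k 2 with hk | hk
  · obtain rfl : k = 1 := by have := h.hk; omega
    simp only [Fin.sum_univ_one] at h1 hc ⊢
    have hb : 1 ≤ ⌈μ 0 * target 1 δ n⌉₊ := by
      rw [h1, one_mul]; exact Nat.one_le_ceil_iff.2 ht
    have hlt : c 0 < ⌈μ 0 * target 1 δ n⌉₊ + tolerance 1 δ n := by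
      by_contra hcon
      have := dynSlk_notifies_at (μ := μ) (δ := δ) (n := n) 0 (by omega) (not_lt.1 hcon)
      omega
    rw [h1, one_mul] at hlt
    have h2 := Nat.ceil_lt_add_one ht.le
    have h3 : (c 0 : ℝ) + 1 ≤ ⌈target 1 δ n⌉₊ + tolerance 1 δ n := by exact_mod_cast hlt
    have h4 := h.target_lt
    have h5 : (c 0 : ℝ) < n := by
      push_cast at hs
      linarith [(tolerance 1 δ n).cast_nonneg (α := ℝ)]
    exact_mod_cast h5
  · have hs1 := h.tolerance_pos hk
    simp only [dynSlk_notifyCount hs1] at hc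
    set s := tolerance k δ n
    have h2 : ∀ i, (c i : ℝ) ≤ μ i * target k δ n +
        (s * (((c i - ⌈μ i * target k δ n⌉₊) / s : ℕ) : ℝ) + s) := fun i => by
      have hb : 0 ≤ μ i * target k δ n := mul_nonneg (h0 i) ht.le
      have e1 := Nat.ceil_lt_add_one hb
      have e2 := Nat.div_add_mod (c i - ⌈μ i * target k δ n⌉₊) s
      have e3 := Nat.mod_lt (c i - ⌈μ i * target k δ n⌉₊) (show s > 0 by omega)
      -- The strict integer inequality supplies the 1 that absorbs the rounding up of the base.
      have e4 : c i + 1 ≤ ⌈μ i * target k δ n⌉₊ +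
        (s * ((c i - ⌈μ i * target k δ n⌉₊) / s) + s) := by omega
      have e5 : (c i : ℝ) + 1 ≤ ⌈μ i * target k δ n⌉₊ +
        (s * (((c i - ⌈μ i * target k δ n⌉₊) / s : ℕ) : ℝ) + s) := by exact_mod_cast e4
      linarith
    have h3 := Finset.sum_le_sum fun i (_ : i ∈ Finset.univ) => h2 i
    rw [Finset.sum_add_distrib, Finset.sum_add_distrib, ← Finset.sum_mul, h1,
      ← Finset.mul_sum] at h3
    simp only [Finset.sum_const, Finset.card_univ, Fintype.card_fin, nsmul_eq_mul] at h3
    have h4 : ((∑ i, (c i - ⌈μ i * target k δ n⌉₊) / s : ℕ) : ℝ) + 1 ≤ k := by exact_mod_cast hc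
    push_cast at h4
    have h5 : (1 : ℝ) ≤ s := by exact_mod_cast hs1
    have h6 : ((∑ i, c i : ℕ) : ℝ) < n := by
      push_cast
      nlinarith
    exact_mod_cast h6

/-- No luck is needed here: for k ≥ 2, n ≤ 49kL gives n ≤ 7·`scale` ≤ 14ks, and the k notifications
account for ks items. A single player has already reached t ≥ n/4. -/
lemma dynSlk_progress (h : CustomThreshold k δ n) (h1 : ∑ i, μ i = 1)
    (c : Fin k → ℕ)
    (hc : ∑ i, notifyCount ((dynSlk k δ μ).notifies ((dynSlk k δ μ).slack n i)) (c i) = k)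
    (hn : (n : ℝ) ≤ 49 * (k * Real.log (k / δ))) :
    (n : ℝ) ≤ 20 * ∑ i, (c i : ℝ) := by
  have hk1 := h.k_ge_one
  have hn0 := h.n_pos
  rcases Nat.lt_or_ge k 2 with hk | hk
  · obtain rfl : k = 1 := by have := h.hk; omega
    simp only [Fin.sum_univ_one] at h1 ⊢
    have hlt : ⌈μ 0 * target 1 δ n⌉₊ + tolerance 1 δ n ≤ c 0 := by
      by_contra hcon
      have := dynSlk_silent (k := 1) (μ := μ) (δ := δ) (n := n) c
        (fun i => by rw [Subsingleton.elim i 0]; omega)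
      omega
    rw [h1, one_mul] at hlt
    have h3 : (⌈target 1 δ n⌉₊ : ℝ) + tolerance 1 δ n ≤ c 0 := by exact_mod_cast hlt
    have h4 := Nat.le_ceil (target 1 δ n)
    have h5 := sub_target 1 δ n
    have h6 := h.gamma_scale_le
    linarith [(tolerance 1 δ n).cast_nonneg (α := ℝ)]
  · have hs1 := h.tolerance_pos hk
    simp only [dynSlk_notifyCount hs1] at hc
    have h2 := h.scale_le_tolerance hk
    set s := tolerance k δ n
    have h3 : ∑ i : Fin k, s * ((c i - ⌈μ i * target k δ n⌉₊) / s) ≤ ∑ i, c i :=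
      Finset.sum_le_sum fun i _ => (Nat.mul_div_le _ _).trans (Nat.sub_le _ _)
    rw [← Finset.mul_sum, hc] at h3
    have h4 : (s * k : ℝ) ≤ ∑ i, (c i : ℝ) := by exact_mod_cast h3
    have h5 : (n : ℝ) ≤ 7 * scale k δ n := by
      apply le_of_sq_le_sq _ (mul_nonneg (by norm_num) h.scale_pos.le)
      have := h.scale_sq
      nlinarith
    linarith

end Rounds

/-! ### The potential that bounds the number of rounds. -/

section Potential
variable {k : ℕ} {L : ℝ}

/-- An upper bound for the number of rounds after the fast phase, where the threshold is at most
`17 e k L`. -/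
noncomputable def slowBound (L : ℝ) : ℝ :=
  2 + Real.log (max 4 (17 * Real.exp 1 * L)) / Real.log (20 / 19)

/-- An upper bound for the number of rounds that a run with threshold `n` takes, for
`L = log (k/δ)`. -/
noncomputable def potential (k : ℕ) (L : ℝ) (n : ℕ) : ℝ :=
  if n < 4 * k then 1
  else if (n : ℝ) ≤ 17 * Real.exp 1 * (k * L) then 2 + Real.log (n / k) / Real.log (20 / 19)
  else slowBound L + 1 + Real.log (Real.log (n / (17 * (k * L)))) / Real.log 2

lemma log_ratio_pos : 0 < Real.log (20 / 19) := Real.log_pos (by norm_num)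

lemma one_le_slowBound : 1 ≤ slowBound L := by
  have h1 : 0 ≤ Real.log (max 4 (17 * Real.exp 1 * L)) :=
    Real.log_nonneg (le_max_of_le_left (by norm_num))
  have := div_nonneg h1 log_ratio_pos.le
  unfold slowBound
  linarith

lemma log_threshold_ge {n : ℕ} (hk : 1 ≤ k) (hn : 4 * k ≤ n) :
    Real.log (20 / 19) ≤ Real.log (n / k) := by
  have hk' : (1 : ℝ) ≤ k := by exact_mod_cast hk
  have hn' : (4 * k : ℝ) ≤ n := by exact_mod_cast hn
  apply Real.log_le_log (by norm_num)
  rw [le_div_iff₀ (by linarith)]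
  linarith

/-- The factor e in the phase boundary serves to make the outer logarithm of `potential` positive
throughout the fast phase. -/
lemma one_lt_log {n : ℕ} (hk : 1 ≤ k) (hL : 0 < L) (hf : 17 * Real.exp 1 * (k * L) < n) :
    1 < Real.log (n / (17 * (k * L))) := by
  have hk' : (1 : ℝ) ≤ k := by exact_mod_cast hk
  have hkL : 0 < k * L := by positivity
  rw [Real.lt_log_iff_exp_lt (by
    have := (mul_pos (mul_pos (by norm_num : (0 : ℝ) < 17) (Real.exp_pos 1)) hkL).trans hf
    positivity), lt_div_iff₀ (by positivity)]
  linarith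

lemma potential_le_slowBound {n : ℕ} (hk : 1 ≤ k)
    (hs : n < 4 * k ∨ (n : ℝ) ≤ 17 * Real.exp 1 * (k * L)) : potential k L n ≤ slowBound L := by
  have hk' : (1 : ℝ) ≤ k := by exact_mod_cast hk
  unfold potential
  split_ifs with h1 h2
  · exact one_le_slowBound
  · unfold slowBound
    have hn' : (4 * k : ℝ) ≤ n := by exact_mod_cast not_lt.1 h1
    have hn0 : (0 : ℝ) < n := by linarith
    have h3 : (n : ℝ) / k ≤ max 4 (17 * Real.exp 1 * L) := by
      apply le_max_of_le_right
      rw [div_le_iff₀ (by linarith)]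
      linarith
    have h4 := Real.log_le_log (by positivity) h3
    have := div_le_div_of_nonneg_right h4 log_ratio_pos.le
    linarith
  · tauto

lemma slowBound_add_one_le_potential {n : ℕ} (hk : 1 ≤ k) (hL : 0 < L) (hn : 4 * k ≤ n)
    (hf : 17 * Real.exp 1 * (k * L) < n) : slowBound L + 1 ≤ potential k L n := by
  rw [potential, if_neg (not_lt.2 hn), if_neg (not_le.2 hf)]
  have h1 := Real.log_nonneg (one_lt_log hk hL hf).le
  have := div_nonneg h1 (Real.log_nonneg one_le_two)
  linarith

lemma one_le_potential {n : ℕ} (hk : 1 ≤ k) (hL : 0 < L) : 1 ≤ potential k L n := by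
  rcases Nat.lt_or_ge n (4 * k) with h1 | h1
  · rw [potential, if_pos h1]
  rcases le_or_gt (n : ℝ) (17 * Real.exp 1 * (k * L)) with h2 | h2
  · rw [potential, if_neg (not_lt.2 h1), if_pos h2]
    have := div_nonneg (log_ratio_pos.le.trans (log_threshold_ge hk h1)) log_ratio_pos.le
    linarith
  · have := slowBound_add_one_le_potential hk hL h1 h2
    have := one_le_slowBound (L := L)
    linarith

lemma potential_slow {n n' : ℕ} (hk : 1 ≤ k) (hn : 4 * k ≤ n)
    (hs : (n : ℝ) ≤ 17 * Real.exp 1 * (k * L)) (hn' : (n' : ℝ) ≤ 19 / 20 * n) :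
    potential k L n' + 1 ≤ potential k L n := by
  have hk' : (1 : ℝ) ≤ k := by exact_mod_cast hk
  have h0 := log_ratio_pos
  have hlog := log_threshold_ge hk hn
  have hnR : (4 * k : ℝ) ≤ n := by exact_mod_cast hn
  have hnn : (0 : ℝ) < n := by linarith
  rw [potential, potential, if_neg (not_lt.2 hn), if_pos hs]
  have hle : (n' : ℝ) ≤ n := by linarith
  split_ifs with h1 h2
  · have := (one_le_div h0).2 hlog
    linarith
  · have h3 : Real.log (n' / k) + Real.log (20 / 19) ≤ Real.log (n / k) := by
      have hn4 : (4 * k : ℝ) ≤ n' := by exact_mod_cast not_lt.1 h1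
      have hn0 : (0 : ℝ) < n' := by linarith
      rw [← Real.log_mul (by positivity) (by norm_num)]
      apply Real.log_le_log (by positivity)
      rw [div_mul_eq_mul_div]
      gcongr
      linarith
    have h4 : (Real.log (n' / k) + Real.log (20 / 19)) / Real.log (20 / 19) ≤
        Real.log (n / k) / Real.log (20 / 19) := by gcongr
    rw [add_div, div_self h0.ne'] at h4
    linarith
  · exact absurd (hle.trans hs) h2

/-- With w = n/(17kL) the hypothesis reads w'² ≤ w. So log w at least halves and log log w loses log
2. If n' leaves the fast phase, the extra 1 above `slowBound` pays for the round. -/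
lemma potential_fast {n n' : ℕ} (hk : 1 ≤ k) (hL : 0 < L) (hn : 4 * k ≤ n)
    (hf : 17 * Real.exp 1 * (k * L) < n) (hn' : (n' : ℝ) ^ 2 ≤ 17 * (k * L) * n) :
    potential k L n' + 1 ≤ potential k L n := by
  have hk' : (1 : ℝ) ≤ k := by exact_mod_cast hk
  have hkL : 0 < k * L := by positivity
  by_cases hs : n' < 4 * k ∨ (n' : ℝ) ≤ 17 * Real.exp 1 * (k * L)
  · have := potential_le_slowBound (L := L) hk hs
    have := slowBound_add_one_le_potential hk hL hn hf
    linarith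
  · rw [not_or, not_lt, not_le] at hs
    have hu' := one_lt_log hk hL hs.2
    have hu := one_lt_log hk hL hf
    rw [potential, potential, if_neg (not_lt.2 hn), if_neg (not_le.2 hf), if_neg (not_lt.2 hs.1),
      if_neg (not_le.2 hs.2)]
    have hn0 : (0 : ℝ) < n' := lt_trans (by positivity) hs.2
    have hw : ((n' : ℝ) / (17 * (k * L))) ^ 2 ≤ n / (17 * (k * L)) := by
      rw [div_pow, div_le_div_iff₀ (by positivity) (by positivity)]
      calc (n' : ℝ) ^ 2 * (17 * (k * L)) ≤ 17 * (k * L) * n * (17 * (k * L)) := by gcongr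
        _ = n * (17 * (k * L)) ^ 2 := by ring
    have h2 := Real.log_le_log (by positivity) hw
    rw [Real.log_pow] at h2
    have h3 := Real.log_le_log (by push_cast; linarith) h2
    rw [Real.log_mul (by norm_num) (by linarith)] at h3
    have hl2 : 0 < Real.log 2 := Real.log_pos one_lt_two
    have h4 := div_le_div_of_nonneg_right h3 hl2.le
    push_cast at h4
    rw [add_div, div_self hl2.ne'] at h4
    linarith

lemma inv_log_two_le : 1 / Real.log 2 ≤ 2 := by
  rw [div_le_iff₀ (Real.log_pos one_lt_two)]
  linarith [Real.log_two_gt_d9]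

lemma loglog_nonneg (y : ℝ) : 0 ≤ loglog y := Real.posLog_nonneg

lemma potential_le {n : ℕ} (hk : 1 ≤ k) (hL : 0 < L) :
    potential k L n ≤ slowBound L + 1 + 2 * loglog (n / (k * L)) := by
  have hk' : (1 : ℝ) ≤ k := by exact_mod_cast hk
  have hkL : 0 < k * L := by positivity
  have hll := loglog_nonneg (n / (k * L))
  by_cases hs : n < 4 * k ∨ (n : ℝ) ≤ 17 * Real.exp 1 * (k * L)
  · have := potential_le_slowBound (L := L) hk hs
    linarith
  · rw [not_or, not_lt, not_le] at hs
    rw [potential, if_neg (not_lt.2 hs.1), if_neg (not_le.2 hs.2)]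
    have hu := one_lt_log hk hL hs.2
    have hn0 : (0 : ℝ) < n := lt_trans (by positivity) hs.2
    have h1 : Real.log (n / (17 * (k * L))) ≤ Real.posLog (n / (k * L)) := by
      refine le_trans ?_ (le_max_right 0 _)
      apply Real.log_le_log (by positivity)
      apply div_le_div_of_nonneg_left hn0.le hkL
      linarith
    have h2 : Real.log (Real.log (n / (17 * (k * L)))) ≤ loglog (n / (k * L)) :=
      (Real.log_le_log (by linarith) h1).trans (le_max_right 0 _)
    have h3 : Real.log (Real.log (n / (17 * (k * L)))) / Real.log 2 ≤
        loglog (n / (k * L)) * (1 / Real.log 2) := by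
      rw [mul_one_div]
      gcongr
    nlinarith [inv_log_two_le]

/-- Since 17e ≤ e⁴ and log(20/19) ≥ 1/20, the bound is 2 + 20(4 + log⁺ L). -/
lemma slowBound_le (hL : 0 < L) : slowBound L ≤ 82 + 20 * Real.posLog L := by
  have h1 : 1 / 20 ≤ Real.log (20 / 19) := by
    have := Real.one_sub_inv_le_log_of_pos (show (0 : ℝ) < 20 / 19 by norm_num)
    norm_num at this ⊢
    linarith
  have he := Real.exp_one_lt_d9
  have he' := Real.exp_one_gt_d9
  have h2 : Real.log (max 4 (17 * Real.exp 1 * L)) ≤ 4 + Real.posLog L := by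
    have h3 : max 4 (17 * Real.exp 1 * L) ≤ Real.exp 4 * max 1 L := by
      have h4 : 17 * Real.exp 1 ≤ Real.exp 4 := by
        have : Real.exp 4 = Real.exp 1 ^ 3 * Real.exp 1 := by
          rw [← pow_succ, ← Real.exp_nat_mul]; norm_num
        rw [this]
        gcongr
        nlinarith [pow_le_pow_left₀ (by norm_num) he'.le 3]
      apply max_le
      · have : (1 : ℝ) ≤ max 1 L := le_max_left _ _
        nlinarith
      · have : L ≤ max 1 L := le_max_right _ _
        gcongr
    refine (Real.log_le_log (by positivity) h3).trans ?_
    rw [Real.log_mul (by positivity) (by positivity), Real.log_exp,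
      Real.posLog_eq_log_max_one hL.le]
  have h5 : 0 ≤ Real.log (max 4 (17 * Real.exp 1 * L)) :=
    Real.log_nonneg (le_max_of_le_left (by norm_num))
  have h6 : Real.log (max 4 (17 * Real.exp 1 * L)) / Real.log (20 / 19) ≤
      Real.log (max 4 (17 * Real.exp 1 * L)) / (1 / 20) := by gcongr
  rw [slowBound]
  linarith

end Potential

/-! ### Invariants of an execution. -/

section Invariant
variable {k : ℕ}

/-- The number of items that arrive at player `i` in the time interval `[a, b)`. -/
def tally (x : ℕ → Fin k) (a b : ℕ) (i : Fin k) : ℕ := ((Finset.Ico a b).filter (x · = i)).card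

lemma tally_self (x : ℕ → Fin k) (a : ℕ) : tally x a a = fun _ => 0 := by
  ext i; simp [tally]

lemma tally_succ (x : ℕ → Fin k) {a b : ℕ} (h : a ≤ b) :
    tally x a (b + 1) = Function.update (tally x a b) (x b) (tally x a b (x b) + 1) := by
  ext i
  rw [tally, ← Finset.insert_Ico_right_eq_Ico_add_one h, Finset.filter_insert]
  by_cases hi : x b = i
  · subst hi
    rw [if_pos rfl, Finset.card_insert_of_notMem (by simp)]
    simp [tally]
  · rw [if_neg hi, Function.update_of_ne (Ne.symm hi), tally]

lemma tally_mono (x : ℕ → Fin k) {a b c : ℕ} (h : b ≤ c) (i : Fin k) :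
    tally x a b i ≤ tally x a c i :=
  Finset.card_le_card (Finset.filter_subset_filter _ (Finset.Ico_subset_Ico_right h))

lemma sum_eq_add_of_eq_off {g h : Fin k → ℕ} {i : Fin k} {e : ℕ} (hi : h i = g i + e)
    (hne : ∀ j, j ≠ i → h j = g j) : ∑ j, h j = ∑ j, g j + e := by
  have : h = fun j => g j + if j = i then e else 0 := by
    ext j
    by_cases hj : j = i
    · subst hj; simp [hi]
    · simp [hj, hne j hj]
  rw [this, Finset.sum_add_distrib]
  simp

/-- The state `st` after `τ` items, in the middle of a slack round with characteristics `A`, of an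
execution with threshold `N`; `V n` bounds the number of rounds from threshold `n` on. -/
structure SlackInv (A : Characteristics k) (V : ℕ → ℝ) (N τ : ℕ) (st : State k) : Prop where
  time : N + ∑ i, st.cnt i = τ + st.thr
  sum_lt : ∑ i, st.cnt i < st.thr
  notes_eq : st.notes = ∑ i, notifyCount (A.notifies (A.slack st.thr i)) (st.cnt i)
  notes_lt : st.notes < k
  -- Each earlier round is charged 5k; the current one has cost k for its start plus its
  -- notifications. In the next field, the 1 appears because the current round is counted both in
  -- `rounds` and in `V st.thr`.
  msgs_le : st.msgs + 4 * k ≤ 5 * k * st.rounds + st.notes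
  rounds_le : st.rounds + V st.thr ≤ V N + 1

/-- The sum of the counters is below the threshold before the item, hence at most the threshold
after it. So at the k-th notification the truncated subtraction in the new threshold is exact. -/
lemma SlackInv.slackStep {A : Characteristics k} {V : ℕ → ℝ} {N τ : ℕ} {st : State k}
    (h : SlackInv A V N τ st) (hell : A.ell = k)
    (hsafe : ∀ c : Fin k → ℕ,
      ∑ i, notifyCount (A.notifies (A.slack st.thr i)) (c i) < k → ∑ i, c i < st.thr)
    (next : ℕ → ℕ → ℕ → State k) (i : Fin k) :
    let n := Function.update st.cnt i (st.cnt i + 1)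
    let st' := slackStep A next st i
    (SlackInv A V N (τ + 1) st' ∧ st'.mode = st.mode ∧ st'.thr = st.thr ∧
      st'.rounds = st.rounds ∧ st'.cnt = n) ∨
    (st' = next (st.thr - ∑ j, n j) st.rounds (st.msgs + 1 + 2 * k) ∧
      ∑ j, notifyCount (A.notifies (A.slack st.thr j)) (n j) = k ∧
      ∑ j, n j ≤ st.thr ∧ N + ∑ j, n j = τ + 1 + st.thr ∧
      st.msgs + 1 + 2 * k ≤ 5 * k * st.rounds) := by
  classical
  intro n st'
  have hsum : ∑ j, n j = ∑ j, st.cnt j + 1 :=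
    sum_eq_add_of_eq_off (i := i) (by simp [n]) (fun j hj => by simp [n, hj])
  have hcount : ∑ j, notifyCount (A.notifies (A.slack st.thr j)) (n j) =
      st.notes + if A.notifies (A.slack st.thr i) (n i) then 1 else 0 := by
    rw [h.notes_eq]
    apply sum_eq_add_of_eq_off (i := i)
    · simp [n, notifyCount]
    · intro j hj; simp [n, hj]
  have ht := h.time
  have hl := h.sum_lt
  have hm := h.msgs_le
  have hnl := h.notes_lt
  by_cases hn : A.notifies (A.slack st.thr i) (n i)
  · rw [if_pos hn] at hcount
    by_cases hk : st.notes + 1 = k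
    · right
      refine ⟨?_, by omega, by omega, by omega, by omega⟩
      simp only [st', DistributedTracking.slackStep]
      rw [if_pos hn, if_pos (by rw [hell, hk])]
    · left
      have hst : st' = { st with cnt := n, notes := st.notes + 1, msgs := st.msgs + 1 } := by
        simp only [st', DistributedTracking.slackStep]
        rw [if_pos hn, if_neg (by rw [hell]; exact hk)]
      have hs := hsafe n (by omega)
      rw [hst]
      exact ⟨⟨by dsimp only; omega, hs, by dsimp only; omega, by dsimp only; omega,
        by dsimp only; omega, h.rounds_le⟩, rfl, rfl, rfl, rfl⟩
  · rw [if_neg hn] at hcount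
    left
    have hst : st' = { st with cnt := n } := by
      simp only [st', DistributedTracking.slackStep]
      rw [if_neg hn]
    have hs := hsafe n (by omega)
    rw [hst]
    exact ⟨⟨by dsimp only; omega, hs, by dsimp only; omega, by dsimp only; omega,
      by dsimp only; omega, h.rounds_le⟩, rfl, rfl, rfl, rfl⟩

/-- The length of the initial part of a round with threshold `n` in which, with high probability,
no player sends a notification. -/
noncomputable def quietLength (k : ℕ) (δ : ℝ) (n : ℕ) : ℕ :=
  ⌊target k δ n - 2 * scale k δ n⌋₊

/-- Some player receives enough items to send a notification in the initial part of a round that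
starts at time `τ` with threshold `n`. -/
def Overfull (δ : ℝ) (μ : Fin k → ℝ) (n : ℕ) (x : ℕ → Fin k) (τ : ℕ) : Prop :=
  ∃ i, ⌈μ i * target k δ n⌉₊ + tolerance k δ n ≤ tally x τ (τ + quietLength k δ n) i

/-- A slack round of DynSlk-KwnDst starts at time `τ` and is among the first `R`
rounds. -/
def StartsAt (N : ℕ) (δ : ℝ) (μ : Fin k → ℝ) (R : ℝ) (x : ℕ → Fin k) (τ : ℕ) : Prop :=
  (dynSlkRun N δ μ x τ).mode = .custom ∧ (dynSlkRun N δ μ x τ).cnt = (fun _ => 0) ∧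
    ((dynSlkRun N δ μ x τ).rounds : ℝ) ≤ R ∧ CustomThreshold k δ (N - τ)

/-- The state `st` after `τ` items of an execution of DynSlk-KwnDst with threshold `N`. -/
inductive RunInv (N : ℕ) (δ : ℝ) (μ : Fin k → ℝ) (x : ℕ → Fin k) (τ : ℕ) (st : State k) : Prop
  | alarm (hmode : st.mode = .alarm) (time : N ≤ τ)
      (rounds_le : st.rounds ≤ potential k (Real.log (k / δ)) N)
      (msgs_le : st.msgs ≤ 5 * k * st.rounds)
  | straight (hmode : st.mode = .straightforward) (thr_le : st.thr ≤ 4 * k)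
      (time : N + st.notes = τ + st.thr) (notes_lt : st.notes < st.thr)
      (rounds_le : st.rounds ≤ potential k (Real.log (k / δ)) N)
      (msgs_le : st.msgs + 4 * k ≤ 5 * k * st.rounds + st.notes)
  | cmy (hmode : st.mode = .cmy) (le_thr : 4 * k ≤ st.thr)
      (thr_le : (st.thr : ℝ) ≤ 2 * (√2 + 2 / 3) ^ 2 * k * Real.log (k / δ))
      (inv : SlackInv (cmy k) (potential k (Real.log (k / δ))) N τ st)
  | custom (hmode : st.mode = .custom) (hthr : CustomThreshold k δ st.thr)
      (inv : SlackInv (dynSlk k δ μ) (potential k (Real.log (k / δ))) N τ st)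
      (hcnt : st.cnt = tally x (N - st.thr) τ)
      (hstart : StartsAt N δ μ st.rounds x (N - st.thr))

lemma sum_notifyCount_zero (A : Characteristics k) (n : ℕ) :
    ∑ i, notifyCount (A.notifies (A.slack n i)) 0 = 0 := by simp [notifyCount]

section Steps
variable {N : ℕ} {δ : ℝ} {μ : Fin k → ℝ} {x : ℕ → Fin k} {τ n r m : ℕ}

lemma RunInv.startStraight (hk : 1 ≤ k) (h0 : 0 < δ) (h1 : δ < 1) (hn : n ≤ 4 * k)
    (time : N = τ + n)
    (hr : r + potential k (Real.log (k / δ)) n ≤ potential k (Real.log (k / δ)) N)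
    (hm : m ≤ 5 * k * r) :
    RunInv N δ μ x τ (startRound .straightforward n r m) := by
  have hp := one_le_potential (n := n) hk (log_pos hk h0 h1)
  by_cases hn0 : n = 0
  · rw [startRound, if_pos hn0]
    exact .alarm rfl (by omega) (by dsimp only; linarith) hm
  · rw [startRound, if_neg hn0]
    refine .straight rfl hn (by dsimp only; omega) (by dsimp only; omega) ?_ ?_
    · push_cast; linarith
    · dsimp only; rw [Nat.mul_add]; omega

lemma RunInv.startCMY (hk : 1 ≤ k) (h0 : 0 < δ) (h1 : δ < 1)
    (hn : (n : ℝ) ≤ 2 * (√2 + 2 / 3) ^ 2 * k * Real.log (k / δ))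
    (time : N = τ + n)
    (hr : r + potential k (Real.log (k / δ)) n ≤ potential k (Real.log (k / δ)) N)
    (hm : m ≤ 5 * k * r) :
    RunInv N δ μ x τ (startCMY n r m) := by
  rw [DistributedTracking.startCMY]
  by_cases h4 : n < 4 * k
  · rw [if_pos h4]
    exact .startStraight hk h0 h1 h4.le time hr hm
  · rw [if_neg h4, startRound, if_neg (by omega)]
    refine .cmy rfl (not_lt.1 h4) hn ⟨?_, ?_, ?_, ?_, ?_, ?_⟩
    · simp; omega
    · simp; omega
    · exact (sum_notifyCount_zero _ _).symm
    · dsimp only; omega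
    · dsimp only; rw [Nat.mul_add]; omega
    · push_cast; linarith

/-- Stated for the run itself rather than for an arbitrary state, because `StartsAt` refers to the
run at the time the round starts. -/
lemma RunInv.startFramework (hk : 1 ≤ k) (h0 : 0 < δ) (h1 : δ < 1)
    (time : N = τ + n)
    (hr : r + potential k (Real.log (k / δ)) n ≤ potential k (Real.log (k / δ)) N)
    (hm : m ≤ 5 * k * r)
    (hrun : dynSlkRun N δ μ x τ = startFramework (2 * (√2 + 2 / 3) ^ 2) δ n r m) :
    RunInv N δ μ x τ (dynSlkRun N δ μ x τ) := by
  have hrun' := hrun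
  rw [DistributedTracking.startFramework] at hrun'
  split_ifs at hrun' with h4 hb
  · rw [hrun']
    exact .startStraight hk h0 h1 h4 time hr hm
  · rw [hrun']
    exact .startCMY hk h0 h1 hb time hr hm
  · rw [startRound, if_neg (by omega)] at hrun'
    have hthr : (dynSlkRun N δ μ x τ).thr = n := by rw [hrun']
    have htau : N - n = τ := by omega
    refine .custom (by rw [hrun']) ?_ ?_ ?_ ?_
    · rw [hthr]
      exact ⟨hk, h0, h1, not_le.1 h4, not_le.1 hb⟩
    · rw [hrun']
      refine ⟨?_, ?_, ?_, ?_, ?_, ?_⟩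
      · simp; omega
      · simp; omega
      · exact (sum_notifyCount_zero _ _).symm
      · dsimp only; omega
      · dsimp only; rw [Nat.mul_add]; omega
      · push_cast; linarith
    · rw [hthr, htau, tally_self, hrun']
    · rw [hthr, htau]
      refine ⟨by rw [hrun'], by rw [hrun'], le_rfl, ?_⟩
      rw [show N - τ = n by omega]
      exact ⟨hk, h0, h1, not_le.1 h4, not_le.1 hb⟩

end Steps

end Invariant

/-! ### Correctness and cost of an execution without failures. -/

section Run
variable {k N : ℕ} {δ : ℝ} {μ : Fin k → ℝ} {x : ℕ → Fin k}

lemma sum_tally (x : ℕ → Fin k) (a b : ℕ) : ∑ i, tally x a b i = b - a := by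
  have := Finset.card_eq_sum_card_fiberwise (s := Finset.Ico a b) (t := Finset.univ) (f := x)
    (fun _ _ => Finset.mem_univ _)
  rw [Nat.card_Ico] at this
  exact this.symm

/-- The round outlasts its quiet part, so at most n - t + 2·`scale` ≤ 4.1·`scale` items remain, and
4.1² < 17. -/
lemma remaining_sq_le {n τ τ' : ℕ} (h : CustomThreshold k δ n) (hover : ¬ Overfull δ μ n x τ)
    (hsum : τ' - τ ≤ n)
    (hc : ∑ i, notifyCount ((dynSlk k δ μ).notifies ((dynSlk k δ μ).slack n i))
      (tally x τ τ' i) = k) :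
    ((n - (τ' - τ) : ℕ) : ℝ) ^ 2 ≤ 17 * (k * Real.log (k / δ)) * n := by
  have hlong : quietLength k δ n + 1 ≤ τ' - τ := by
    by_contra hcon
    have hle : τ' ≤ τ + quietLength k δ n := by omega
    rw [Overfull, not_exists] at hover
    have := dynSlk_silent (μ := μ) (δ := δ) (n := n) (tally x τ τ')
      fun i => (tally_mono x hle i).trans_lt (not_le.1 (hover i))
    have := h.hk
    omega
  have h1 : target k δ n - 2 * scale k δ n < quietLength k δ n + 1 := Nat.lt_floor_add_one _
  have h2 : (quietLength k δ n : ℝ) + 1 ≤ (τ' - τ : ℕ) := by exact_mod_cast hlong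
  have h3 := sub_target k δ n
  have h4 := h.scale_pos
  have h5 : (√2 + 2 / 3) * scale k δ n ≤ 21 / 10 * scale k δ n := by
    gcongr; exact gamma_bounds.2
  have h6 : ((n - (τ' - τ) : ℕ) : ℝ) ≤ 41 / 10 * scale k δ n := by
    rw [Nat.cast_sub hsum]; linarith
  have h7 := pow_le_pow_left₀ (Nat.cast_nonneg _) h6 2
  have h8 := h.scale_sq
  nlinarith

/-- No slack round among the first `R` is overfull. -/
def NoFailure (N : ℕ) (δ : ℝ) (μ : Fin k → ℝ) (R : ℝ) (x : ℕ → Fin k) : Prop :=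
  ∀ τ < N, StartsAt N δ μ R x τ → ¬ Overfull δ μ (N - τ) x τ

/-- The number of rounds in the fast phase. -/
noncomputable def fastRounds (k : ℕ) (δ : ℝ) (N : ℕ) : ℝ :=
  1 + 2 * loglog (N / (k * Real.log (k / δ)))

lemma exp_one_mul_le : 17 * Real.exp 1 ≤ 49 := by linarith [Real.exp_one_lt_d9]

lemma beta_le : 2 * (√2 + 2 / 3) ^ 2 ≤ 17 * Real.exp 1 := by
  have := pow_le_pow_left₀ (by positivity) gamma_bounds.2 2
  linarith [Real.exp_one_gt_d9]

/-- In the fast phase the potential of n is at least `slowBound` + 1, while that of N is at most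
`slowBound` + `fastRounds`. Hence `hr` forces r ≤ `fastRounds`, and the absence of failures among
these rounds suffices. -/
lemma potential_custom_step {n τ τ' r : ℕ} (h : CustomThreshold k δ n) (h1 : ∑ i, μ i = 1)
    (hfail : NoFailure N δ μ (fastRounds k δ N) x) (hN : N = τ + n)
    (hstart : StartsAt N δ μ r x τ)
    (hr : r + potential k (Real.log (k / δ)) n ≤ potential k (Real.log (k / δ)) N + 1)
    (hsum : τ' - τ ≤ n)
    (hc : ∑ i, notifyCount ((dynSlk k δ μ).notifies ((dynSlk k δ μ).slack n i))
      (tally x τ τ' i) = k) :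
    potential k (Real.log (k / δ)) (n - (τ' - τ)) + 1 ≤ potential k (Real.log (k / δ)) n := by
  have hL := log_pos h.hk h.δ_pos h.δ_lt
  have hk1 := h.k_ge_one
  have h4 := h.four_lt
  rcases le_or_gt (n : ℝ) (17 * Real.exp 1 * (k * Real.log (k / δ))) with hs | hf
  · refine potential_slow h.hk h4.le hs ?_
    have hp := dynSlk_progress h h1 _ hc (hs.trans (by gcongr; exact exp_one_mul_le))
    rw [← Nat.cast_sum, sum_tally] at hp
    rw [Nat.cast_sub hsum]
    linarith
  · refine potential_fast h.hk hL h4.le hf (remaining_sq_le h ?_ hsum hc)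
    have hp := slowBound_add_one_le_potential h.hk hL h4.le hf
    have hP := potential_le (n := N) h.hk hL
    have := hfail τ (by omega) ⟨hstart.1, hstart.2.1, hstart.2.2.1.trans (by
      rw [fastRounds]; linarith), hstart.2.2.2⟩
    rwa [hN, Nat.add_sub_cancel_left] at this

theorem runInv (hk : 1 ≤ k) (h0 : 0 < δ) (h1 : δ < 1) (hμ0 : ∀ i, 0 ≤ μ i) (hμ1 : ∑ i, μ i = 1)
    (hfail : NoFailure N δ μ (fastRounds k δ N) x) (τ : ℕ) :
    RunInv N δ μ x τ (dynSlkRun N δ μ x τ) := by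
  induction τ with
  | zero =>
    exact .startFramework hk h0 h1 (r := 0) (m := 0) (n := N) (by omega) (by simp) (by omega) rfl
  | succ τ ih =>
    have hstep : dynSlkRun N δ μ x (τ + 1) =
      step (dynSlk k δ μ) (2 * (√2 + 2 / 3) ^ 2) δ (dynSlkRun N δ μ x τ) (x τ) := rfl
    cases ih with
    | alarm hmode time rounds_le msgs_le =>
      have hst : dynSlkRun N δ μ x (τ + 1) = dynSlkRun N δ μ x τ := by
        rw [hstep]; simp only [step, hmode]
      rw [hst]
      exact .alarm hmode (by omega) rounds_le msgs_le
    | straight hmode thr_le time notes_lt rounds_le msgs_le =>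
      have hst : dynSlkRun N δ μ x (τ + 1) = straightStep (dynSlkRun N δ μ x τ) (x τ) := by
        rw [hstep]; simp only [step, hmode]
      rw [hst]
      by_cases hlast : (dynSlkRun N δ μ x τ).notes + 1 = (dynSlkRun N δ μ x τ).thr
      · exact .alarm (by simp [straightStep, hlast]) (by omega) rounds_le
          (by dsimp only [straightStep]; omega)
      · exact .straight (by simp [straightStep, hlast]) thr_le
          (by dsimp only [straightStep]; omega) (by dsimp only [straightStep]; omega) rounds_le
          (by dsimp only [straightStep]; omega)
    | cmy hmode le_thr thr_le inv =>
      have hst : dynSlkRun N δ μ x (τ + 1) =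
          slackStep (DistributedTracking.cmy k) startCMY (dynSlkRun N δ μ x τ) (x τ) := by
        rw [hstep]; simp only [step, hmode]
      have hs := inv.slackStep rfl (cmy_sum_lt hk le_thr) startCMY (x τ)
      rw [← hst] at hs
      rcases hs with ⟨hinv, hm, ht, -, -⟩ | ⟨heq, hcount, hle, htime, hmsgs⟩
      · exact .cmy (hm.trans hmode) (ht ▸ le_thr) (ht ▸ thr_le) hinv
      · rw [heq]
        have hp := cmy_progress hk le_thr _ hcount
        have hr := inv.rounds_le
        have hp' : ((dynSlkRun N δ μ x τ).thr : ℝ) ≤ 4 * (∑ j, Function.update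
          (dynSlkRun N δ μ x τ).cnt (x τ) ((dynSlkRun N δ μ x τ).cnt (x τ) + 1) j : ℕ) := by
          exact_mod_cast hp
        have hk1 : (1 : ℝ) ≤ k := by exact_mod_cast hk
        have hL := log_pos hk h0 h1
        -- As β ≤ 17e, CMY runs only in the slow phase.
        have hpot := potential_slow (L := Real.log (k / δ)) hk le_thr
          (thr_le.trans (by 
            rw [mul_assoc]; exact mul_le_mul_of_nonneg_right beta_le (by positivity)))
          (n' := (dynSlkRun N δ μ x τ).thr - ∑ j, Function.update
          (dynSlkRun N δ μ x τ).cnt (x τ) ((dynSlkRun N δ μ x τ).cnt (x τ) + 1) j)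
          (by rw [Nat.cast_sub hle]; linarith)
        refine .startCMY hk h0 h1 (le_trans ?_ thr_le) (by omega) (by linarith) hmsgs
        exact_mod_cast Nat.sub_le _ _
    | custom hmode hthr inv hcnt hstart =>
      have hst : dynSlkRun N δ μ x (τ + 1) = slackStep (dynSlk k δ μ)
          (startFramework (2 * (√2 + 2 / 3) ^ 2) δ) (dynSlkRun N δ μ x τ) (x τ) := by
        rw [hstep]; simp only [step, hmode]
      have hs := inv.slackStep rfl (dynSlk_sum_lt hthr hμ0 hμ1)
        (startFramework (2 * (√2 + 2 / 3) ^ 2) δ) (x τ)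
      have htime := inv.time
      rw [hcnt, sum_tally] at htime
      have hN : N = (N - (dynSlkRun N δ μ x τ).thr) + (dynSlkRun N δ μ x τ).thr ∧
        N - (dynSlkRun N δ μ x τ).thr ≤ τ := by omega
      have hcnt' : Function.update (dynSlkRun N δ μ x τ).cnt (x τ)
          ((dynSlkRun N δ μ x τ).cnt (x τ) + 1) =
          tally x (N - (dynSlkRun N δ μ x τ).thr) (τ + 1) := by
        rw [tally_succ x hN.2, ← hcnt]
      rw [← hst, hcnt'] at hs
      rcases hs with ⟨hinv, hm, ht, hr, hc⟩ | ⟨heq, hcount, hle, htime, hmsgs⟩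
      · refine .custom (hm.trans hmode) (ht ▸ hthr) hinv (by rw [hc, ht]) ?_
        rw [ht, hr]; exact hstart
      · rw [sum_tally] at heq hle htime
        have hpot := potential_custom_step hthr hμ1 hfail hN.1 hstart inv.rounds_le hle hcount
        have hr := inv.rounds_le
        exact .startFramework hk h0 h1 (by omega) (by linarith) hmsgs heq

theorem run_spec (hk : 1 ≤ k) (h0 : 0 < δ) (h1 : δ < 1) (hμ0 : ∀ i, 0 ≤ μ i)
    (hμ1 : ∑ i, μ i = 1) (hfail : NoFailure N δ μ (fastRounds k δ N) x) :
    (∀ m, (dynSlkRun N δ μ x m).mode = Mode.alarm ↔ N ≤ m) ∧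
    ((dynSlkRun N δ μ x N).rounds : ℝ) ≤ potential k (Real.log (k / δ)) N ∧
    (dynSlkRun N δ μ x N).msgs ≤ 5 * k * (dynSlkRun N δ μ x N).rounds := by
  have hinv := runInv hk h0 h1 hμ0 hμ1 hfail
  have halarm : ∀ m, (dynSlkRun N δ μ x m).mode = Mode.alarm ↔ N ≤ m := by
    intro m
    cases hinv m with
    | alarm hmode time _ _ => simp [hmode, time]
    | straight hmode _ time notes_lt _ _ => simp only [hmode, reduceCtorEq, false_iff]; omega
    | cmy hmode _ _ inv =>
      have := inv.time
      have := inv.sum_lt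
      simp only [hmode, reduceCtorEq, false_iff]; omega
    | custom hmode _ inv _ _ =>
      have := inv.time
      have := inv.sum_lt
      simp only [hmode, reduceCtorEq, false_iff]; omega
  refine ⟨halarm, ?_⟩
  have hN := (halarm N).2 le_rfl
  cases hinv N with
  | alarm _ _ rounds_le msgs_le => exact ⟨rounds_le, msgs_le⟩
  | straight hmode => simp [hmode] at hN
  | cmy hmode => simp [hmode] at hN
  | custom hmode => simp [hmode] at hN

end Run

/-! ### Counting the starts of rounds. -/

section Starts
variable {k N : ℕ} {δ : ℝ} {μ : Fin k → ℝ} {x y : ℕ → Fin k}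

lemma startRound_rounds (mode : Mode) (n r m : ℕ) :
    (startRound mode n r m : State k).rounds = r + 1 ∨
      ((startRound mode n r m : State k).rounds = r ∧
        (startRound mode n r m : State k).mode = .alarm) := by
  unfold startRound
  split_ifs <;> simp

lemma startFramework_rounds (β δ : ℝ) (n r m : ℕ) :
    (startFramework β δ n r m : State k).rounds = r + 1 ∨
      ((startFramework β δ n r m : State k).rounds = r ∧
        (startFramework β δ n r m : State k).mode = .alarm) := by
  unfold startFramework startCMY
  split_ifs <;> exact startRound_rounds _ _ _ _

lemma slackStep_rounds (A : Characteristics k) {next : ℕ → ℕ → ℕ → State k}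
    (hnext : ∀ n r m, (next n r m).rounds = r + 1 ∨
      ((next n r m).rounds = r ∧ (next n r m).mode = .alarm)) (st : State k) (i : Fin k) :
    (slackStep A next st i).rounds = st.rounds + 1 ∨
      ((slackStep A next st i).rounds = st.rounds ∧
        ((slackStep A next st i).mode = .alarm ∨
          ∑ j, (slackStep A next st i).cnt j = ∑ j, st.cnt j + 1)) := by
  have hsum : ∑ j, Function.update st.cnt i (st.cnt i + 1) j = ∑ j, st.cnt j + 1 :=
    sum_eq_add_of_eq_off (i := i) (by simp) (fun j hj => by simp [hj])
  unfold slackStep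
  dsimp only
  split_ifs
  · rcases hnext (st.thr - ∑ j, Function.update st.cnt i (st.cnt i + 1) j) st.rounds
      (st.msgs + 1 + 2 * k) with h | h
    · exact .inl h
    · exact .inr ⟨h.1, .inl h.2⟩
  · exact .inr ⟨rfl, .inr hsum⟩
  · exact .inr ⟨rfl, .inr hsum⟩

lemma step_rounds (A : Characteristics k) (β δ : ℝ) (st : State k) (i : Fin k) :
    (step A β δ st i).rounds = st.rounds + 1 ∨
      ((step A β δ st i).rounds = st.rounds ∧
        ((step A β δ st i).mode = .alarm ∨
          (st.mode ≠ .alarm ∧ ∑ j, (step A β δ st i).cnt j = ∑ j, st.cnt j + 1))) := by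
  have hsum : ∑ j, Function.update st.cnt i (st.cnt i + 1) j = ∑ j, st.cnt j + 1 :=
    sum_eq_add_of_eq_off (i := i) (by simp) (fun j hj => by simp [hj])
  unfold step
  cases hm : st.mode with
  | alarm => simp [hm]
  | straightforward => simp [straightStep, hsum]
  | cmy =>
    have := slackStep_rounds (cmy k) (next := startCMY)
      (fun _ _ _ => startRound_rounds _ _ _ _) st i
    simpa using this
  | custom =>
    have := slackStep_rounds A (next := startFramework β δ) (startFramework_rounds β δ) st i
    simpa using this

/-- Within a round every item adds one to the sum of the counters, so they cannot be zero at two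
different times of the same round. -/
lemma run_rounds (A : Characteristics k) (β δ : ℝ) (N : ℕ) (x : ℕ → Fin k) (τ d : ℕ) :
    (run A β δ N x τ).rounds < (run A β δ N x (τ + d)).rounds ∨
      ((run A β δ N x τ).rounds = (run A β δ N x (τ + d)).rounds ∧
        ((run A β δ N x (τ + d)).mode = .alarm ∨
          ∑ j, (run A β δ N x (τ + d)).cnt j = ∑ j, (run A β δ N x τ).cnt j + d)) := by
  induction d with
  | zero => simp
  | succ d ih =>
    have hs := step_rounds A β δ (run A β δ N x (τ + d)) (x (τ + d))
    have hr : run A β δ N x (τ + (d + 1)) =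
      step A β δ (run A β δ N x (τ + d)) (x (τ + d)) := rfl
    rw [← hr] at hs
    rcases hs with h | ⟨h, h2 | ⟨h2, h3⟩⟩
    · left; omega
    · rcases ih with ih | ih
      · left; omega
      · exact .inr ⟨by omega, .inl h2⟩
    · rcases ih with ih | ⟨ih, ih2 | ih2⟩
      · left; omega
      · exact absurd ih2 h2
      · exact .inr ⟨by omega, .inr (by omega)⟩

lemma StartsAt.rounds_lt {R : ℝ} {τ τ' : ℕ} (h : StartsAt N δ μ R x τ)
    (h' : StartsAt N δ μ R x τ') (hlt : τ < τ') :
    (dynSlkRun N δ μ x τ).rounds < (dynSlkRun N δ μ x τ').rounds := by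
  obtain ⟨d, rfl⟩ := Nat.exists_eq_add_of_le hlt.le
  obtain ⟨-, hc, -⟩ := h
  obtain ⟨hm', hc', -⟩ := h'
  rcases run_rounds (dynSlk k δ μ) (2 * (√2 + 2 / 3) ^ 2) δ N x τ d with h1 | ⟨-, h2 | h2⟩
  · exact h1
  · rw [← dynSlkRun, hm'] at h2
    simp at h2
  · rw [← dynSlkRun, ← dynSlkRun, hc, hc'] at h2
    simp at h2
    omega

open Classical in
lemma card_startsAt_le {R : ℝ} (hR : 0 ≤ R) :
    (((Finset.range N).filter (StartsAt N δ μ R x)).card : ℝ) ≤ R + 1 := by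
  have h1 : ((Finset.range N).filter (StartsAt N δ μ R x)).card ≤
      (Finset.range (⌊R⌋₊ + 1)).card := by
    refine Finset.card_le_card_of_injOn (fun τ => (dynSlkRun N δ μ x τ).rounds) ?_ ?_
    · intro τ hτ
      have := (Finset.mem_filter.1 hτ).2.2.2.1
      simpa [Nat.lt_succ_iff] using Nat.le_floor this
    · intro τ hτ τ' hτ' heq
      have h := (Finset.mem_filter.1 hτ).2
      have h' := (Finset.mem_filter.1 hτ').2
      rcases lt_trichotomy τ τ' with hlt | hlt | hlt
      · exact absurd heq (h.rounds_lt h' hlt).ne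
      · exact hlt
      · exact absurd heq (h'.rounds_lt h hlt).ne'
  rw [Finset.card_range] at h1
  have h2 : (((Finset.range N).filter (StartsAt N δ μ R x)).card : ℝ) ≤ ⌊R⌋₊ + 1 := by
    exact_mod_cast h1
  linarith [Nat.floor_le hR]

lemma run_congr (A : Characteristics k) (β δ : ℝ) (N : ℕ) {τ : ℕ} (h : ∀ j < τ, x j = y j) :
    run A β δ N x τ = run A β δ N y τ := by
  induction τ with
  | zero => rfl
  | succ τ ih => rw [run, run, ih fun j hj => h j (by omega), h τ (by omega)]

lemma tally_congr {a b : ℕ} (h : ∀ j ∈ Finset.Ico a b, x j = y j) : tally x a b = tally y a b := by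
  ext i
  rw [tally, tally]
  congr 1
  exact Finset.filter_congr fun j hj => by rw [h j hj]

end Starts

open MeasureTheory ProbabilityTheory

/-! ### The probability of a failure. -/

section Probability
variable {k N : ℕ} {δ : ℝ} {μ : Fin k → ℝ} {Ω : Type*} [MeasurableSpace Ω] {P : Measure Ω}
  {X : ℕ → Ω → Fin k}

lemma tally_eq_sum (x : ℕ → Fin k) (a b : ℕ) (i : Fin k) :
    (tally x a b i : ℝ) = ∑ j ∈ Finset.Ico a b, if x j = i then (1 : ℝ) else 0 := by
  rw [tally, Finset.card_filter]
  push_cast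
  rfl

/-- Combines exp l - 1 ≤ l + l² on [0, 1] with 1 + z ≤ exp z. -/
lemma mgf_ite_le [IsProbabilityMeasure P] (hX : ∀ j, Measurable (X j)) (hdist : ∀ j i, P.real {ω | X j ω = i} = μ i)
    (i : Fin k) (j : ℕ) {l : ℝ} (hl0 : 0 ≤ l) (hl1 : l ≤ 1) :
    mgf (fun ω => if X j ω = i then (1 : ℝ) else 0) P l ≤ Real.exp (μ i * (l + l ^ 2)) := by
  have hset : MeasurableSet {ω | X j ω = i} := hX j (measurableSet_singleton i)
  have hμ : 0 ≤ μ i := by rw [← hdist j i]; positivity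
  have heq : (fun ω => Real.exp (l * if X j ω = i then (1 : ℝ) else 0)) =
      fun ω => 1 + (Real.exp l - 1) * {ω | X j ω = i}.indicator 1 ω := by
    ext ω
    by_cases h : X j ω = i <;> simp [h]
  have hint : Integrable ({ω | X j ω = i}.indicator (1 : Ω → ℝ)) P :=
    (integrable_const (1 : ℝ)).indicator hset
  rw [mgf, heq, integral_add (integrable_const _) (hint.const_mul _), integral_const_mul,
    integral_indicator_one hset, hdist]
  have h1 := (abs_le.1 (Real.abs_exp_sub_one_sub_id_le (x := l)
    (by rw [abs_of_nonneg hl0]; exact hl1))).2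
  have h2 := Real.add_one_le_exp (μ i * (l + l ^ 2))
  simp only [integral_const, probReal_univ, smul_eq_mul, mul_one]
  nlinarith

lemma tally_tail [IsProbabilityMeasure P] (hX : ∀ j, Measurable (X j)) (hind : iIndepFun X P)
    (hdist : ∀ j i, P.real {ω | X j ω = i} = μ i) (i : Fin k) (a q : ℕ) (c : ℝ)
    {l : ℝ} (hl0 : 0 ≤ l) (hl1 : l ≤ 1) :
    P.real {ω | c ≤ tally (X · ω) a (a + q) i} ≤
      Real.exp (q * (μ i * (l + l ^ 2)) - l * c) := by
  set Y : ℕ → Ω → ℝ := fun j ω => if X j ω = i then (1 : ℝ) else 0 with hY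
  have hYm : ∀ j, Measurable (Y j) := fun j =>
    Measurable.ite (hX j (measurableSet_singleton i)) measurable_const measurable_const
  have hYind : iIndepFun Y P :=
    hind.comp (fun _ z => if z = i then (1 : ℝ) else 0) (fun _ => measurable_of_finite _)
  have hset : {ω | c ≤ (tally (X · ω) a (a + q) i : ℝ)} =
      {ω | c ≤ (∑ j ∈ Finset.Ico a (a + q), Y j) ω} := by
    ext ω
    simp [tally_eq_sum, hY]
  have hint : Integrable (fun ω => Real.exp (l * (∑ j ∈ Finset.Ico a (a + q), Y j) ω)) P := by
    refine Integrable.of_bound (C := Real.exp (l * q))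
      (by fun_prop) (Filter.Eventually.of_forall fun ω => ?_)
    rw [Real.norm_eq_abs, abs_of_pos (Real.exp_pos _)]
    gcongr
    rw [Finset.sum_apply]
    calc ∑ j ∈ Finset.Ico a (a + q), Y j ω ≤ ∑ j ∈ Finset.Ico a (a + q), (1 : ℝ) :=
          Finset.sum_le_sum fun j _ => by simp only [hY]; split_ifs <;> norm_num
      _ = q := by simp
  rw [hset]
  refine (measure_ge_le_exp_mul_mgf c hl0 hint).trans ?_
  rw [hYind.mgf_sum hYm]
  have h1 : ∏ j ∈ Finset.Ico a (a + q), mgf (Y j) P l ≤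
      ∏ j ∈ Finset.Ico a (a + q), Real.exp (μ i * (l + l ^ 2)) :=
    Finset.prod_le_prod (fun _ _ => mgf_nonneg) fun j _ => mgf_ite_le hX hdist i j hl0 hl1
  rw [Finset.prod_const, Nat.card_Ico, Nat.add_sub_cancel_left, ← Real.exp_nat_mul] at h1
  calc Real.exp (-l * c) * ∏ j ∈ Finset.Ico a (a + q), mgf (Y j) P l
      ≤ Real.exp (-l * c) * Real.exp (q * (μ i * (l + l ^ 2))) := by gcongr
    _ = Real.exp (q * (μ i * (l + l ^ 2)) - l * c) := by rw [← Real.exp_add]; ring_nf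

/-- Tailored to the Chernoff parameter l = 2·`scale`/n: the excess l·q of a quiet length q ≤ n is at
most 2·`scale`, exactly what was subtracted from t. -/
lemma quietLength_le {n : ℕ} (h : CustomThreshold k δ n) :
    quietLength k δ n * (1 + 2 * scale k δ n / n) ≤ target k δ n := by
  have hn := h.n_pos
  have hs := h.scale_pos
  rcases Nat.eq_zero_or_pos (quietLength k δ n) with h0 | h0
  · rw [h0]; simpa using h.target_pos.le
  · have h1 : (quietLength k δ n : ℝ) ≤ target k δ n - 2 * scale k δ n :=
      Nat.floor_le (Nat.pos_of_floor_pos h0).le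
    have h2 : (quietLength k δ n : ℝ) / n ≤ 1 := by
      rw [div_le_one hn]; linarith [h.target_lt]
    calc quietLength k δ n * (1 + 2 * scale k δ n / n)
        = quietLength k δ n + 2 * scale k δ n * (quietLength k δ n / n) := by ring
      _ ≤ target k δ n := by nlinarith

lemma overfull_prob [IsProbabilityMeasure P] {n : ℕ} (h : CustomThreshold k δ n) (hk : 2 ≤ k)
    (hX : ∀ j, Measurable (X j)) (hind : iIndepFun X P) (hμ0 : ∀ i, 0 ≤ μ i)
    (hdist : ∀ j i, P.real {ω | X j ω = i} = μ i) (τ : ℕ) :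
    P.real {ω | Overfull δ μ n (X · ω) τ} ≤ δ := by
  have hn := h.n_pos
  have hs := h.scale_pos
  have hk1 := h.k_ge_one
  have hδ := h.δ_pos
  -- With this l, `quietLength_le` reduces the Chernoff exponent to at most -l·s, and l·s ≥
  -- `scale`²/(kn) = L. Each player then contributes at most δ/k.
  set l := 2 * scale k δ n / n with hl
  have hl0 : 0 ≤ l := by positivity
  have hl1 : l ≤ 1 := by
    rw [hl, div_le_one hn]
    have h1 := mul_le_mul_of_nonneg_right gamma_bounds.1 hs.le
    linarith [h.gamma_scale_le]
  have hlL : Real.log (k / δ) ≤ l * tolerance k δ n := by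
    have h1 := h.scale_le_tolerance hk
    have h2 := h.scale_sq
    have h3 : scale k δ n * scale k δ n ≤ scale k δ n * (2 * k * tolerance k δ n) := by gcongr
    have h4 : (k * n : ℝ) * Real.log (k / δ) ≤ (k * n) * (l * tolerance k δ n) := by
      calc (k * n : ℝ) * Real.log (k / δ) = scale k δ n * scale k δ n := by rw [← sq, h2]
        _ ≤ scale k δ n * (2 * k * tolerance k δ n) := h3
        _ = (k * n) * (l * tolerance k δ n) := by rw [hl]; field_simp
    exact le_of_mul_le_mul_left h4 (by positivity)
  have htail : ∀ i, P.real {ω | ((⌈μ i * target k δ n⌉₊ + tolerance k δ n : ℕ) : ℝ) ≤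
      tally (X · ω) τ (τ + quietLength k δ n) i} ≤ δ / k := fun i => by
    refine (tally_tail hX hind hdist i τ _ _ hl0 hl1).trans ?_
    have h1 : (δ / k : ℝ) = Real.exp (-Real.log (k / δ)) := by
      rw [Real.exp_neg, Real.exp_log (by positivity), inv_div]
    rw [h1]
    apply Real.exp_le_exp.2
    have h2 := mul_le_mul_of_nonneg_left (quietLength_le h) (mul_nonneg hl0 (hμ0 i))
    rw [← hl] at h2
    have h3 := mul_le_mul_of_nonneg_left (Nat.le_ceil (μ i * target k δ n)) hl0
    push_cast
    nlinarith
  have hset : {ω | Overfull δ μ n (X · ω) τ} = ⋃ i,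
      {ω | ((⌈μ i * target k δ n⌉₊ + tolerance k δ n : ℕ) : ℝ) ≤
        tally (X · ω) τ (τ + quietLength k δ n) i} := by
    ext ω
    simp only [Overfull, Set.mem_ofPred_eq, Set.mem_iUnion, Nat.cast_le]
  rw [hset]
  calc _ ≤ ∑ i, P.real {ω | ((⌈μ i * target k δ n⌉₊ + tolerance k δ n : ℕ) : ℝ) ≤
        tally (X · ω) τ (τ + quietLength k δ n) i} := measureReal_iUnion_fintype_le _
    _ ≤ ∑ _i : Fin k, δ / k := Finset.sum_le_sum fun i _ => htail i
    _ = δ := by simp; field_simp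

lemma not_overfull_of_one_player {n τ : ℕ} {μ : Fin 1 → ℝ} (h : CustomThreshold 1 δ n)
    (hμ1 : ∑ i, μ i = 1) (x : ℕ → Fin 1) : ¬ Overfull δ μ n x τ := by
  rintro ⟨i, hi⟩
  rw [Subsingleton.elim i 0] at hi
  have h1 := sum_tally x τ (τ + quietLength 1 δ n)
  rw [Fin.sum_univ_one] at h1 hμ1
  rw [h1, hμ1, one_mul, Nat.add_sub_cancel_left] at hi
  have h2 : target 1 δ n ≤ quietLength 1 δ n :=
    (Nat.le_ceil _).trans (by exact_mod_cast (Nat.le_add_right _ _).trans hi)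
  have h3 := quietLength_le h
  have hn := h.n_pos
  have hs := h.scale_pos
  have h4 : 0 < 2 * scale 1 δ n / n := by positivity
  have ht := h.target_pos
  nlinarith

/-- Whether a slack round starts at time `τ` is determined by the first `τ` items. -/
lemma preimage_image_startsAt {Ω : Type*} (X : ℕ → Ω → Fin k) (R : ℝ) (τ : ℕ) :
    (fun ω (j : Finset.range τ) => X j ω) ⁻¹'
      ((fun ω (j : Finset.range τ) => X j ω) '' {ω | StartsAt N δ μ R (X · ω) τ}) =
        {ω | StartsAt N δ μ R (X · ω) τ} := by
  refine Set.Subset.antisymm ?_ (Set.subset_preimage_image _ _)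
  rintro ω ⟨ω', h, heq⟩
  have hc : dynSlkRun N δ μ (X · ω) τ = dynSlkRun N δ μ (X · ω') τ :=
    run_congr _ _ _ _ fun j hj => (congrFun heq ⟨j, Finset.mem_range.2 hj⟩).symm
  simpa only [Set.mem_ofPred_eq, StartsAt, hc] using h

/-- The two events depend on disjoint blocks of items. Each is a preimage under finitely many
coordinates with values in a finite type, where all sets are measurable. -/
lemma indep_starts_overfull (hX : ∀ j, Measurable (X j)) (hind : iIndepFun X P) (R : ℝ)
    (n τ : ℕ) :
    P.real ({ω | StartsAt N δ μ R (X · ω) τ} ∩ {ω | Overfull δ μ n (X · ω) τ}) =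
      P.real {ω | StartsAt N δ μ R (X · ω) τ} * P.real {ω | Overfull δ μ n (X · ω) τ} := by
  set f : Ω → (Finset.range τ → Fin k) := fun ω j => X j ω with hf
  set g : Ω → (Finset.Ico τ (τ + quietLength k δ n) → Fin k) := fun ω j => X j ω with hg
  have hfg : IndepFun f g P := hind.indepFun_finset _ _ (by
    rw [Finset.disjoint_left]; intro j hj hj'
    have := Finset.mem_range.1 hj
    have := (Finset.mem_Ico.1 hj').1
    omega) hX
  have hS := preimage_image_startsAt (N := N) (δ := δ) (μ := μ) X R τ
  have hB : g ⁻¹' (g '' {ω | Overfull δ μ n (X · ω) τ}) = {ω | Overfull δ μ n (X · ω) τ} := by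
    refine Set.Subset.antisymm ?_ (Set.subset_preimage_image _ _)
    rintro ω ⟨ω', h, heq⟩
    have hc : tally (X · ω) τ (τ + quietLength k δ n) = tally (X · ω') τ (τ + quietLength k δ n) :=
      tally_congr fun j hj => (congrFun heq ⟨j, hj⟩).symm
    simpa only [Set.mem_ofPred_eq, Overfull, hc] using h
  have := hfg.measure_inter_preimage_eq_mul (f '' {ω | StartsAt N δ μ R (X · ω) τ})
    (g '' {ω | Overfull δ μ n (X · ω) τ}) (Set.toFinite _).measurableSet
    (Set.toFinite _).measurableSet
  rw [hS, hB] at this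
  rw [measureReal_def, this, ENNReal.toReal_mul, measureReal_def, measureReal_def]

lemma measurableSet_startsAt (hX : ∀ j, Measurable (X j)) (R : ℝ) (τ : ℕ) :
    MeasurableSet {ω | StartsAt N δ μ R (X · ω) τ} := by
  rw [← preimage_image_startsAt]
  apply measurable_pi_lambda (fun ω (j : Finset.range τ) => X j ω) fun j => hX j
  exact (Set.toFinite _).measurableSet

lemma sum_startsAt_le [IsProbabilityMeasure P] (hX : ∀ j, Measurable (X j)) {R : ℝ} (hR : 0 ≤ R) :
    ∑ τ ∈ Finset.range N, P.real {ω | StartsAt N δ μ R (X · ω) τ} ≤ R + 1 := by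
  classical
  have hint : ∀ τ ∈ Finset.range N,
      Integrable ({ω | StartsAt N δ μ R (X · ω) τ}.indicator (1 : Ω → ℝ)) P := fun τ _ =>
    (integrable_const (1 : ℝ)).indicator (measurableSet_startsAt hX R τ)
  calc ∑ τ ∈ Finset.range N, P.real {ω | StartsAt N δ μ R (X · ω) τ}
      = ∑ τ ∈ Finset.range N, ∫ ω, {ω | StartsAt N δ μ R (X · ω) τ}.indicator (1 : Ω → ℝ) ω ∂P :=
        Finset.sum_congr rfl fun τ _ =>
          (integral_indicator_one (measurableSet_startsAt hX R τ)).symm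
    _ = ∫ ω, ∑ τ ∈ Finset.range N,
          {ω | StartsAt N δ μ R (X · ω) τ}.indicator (1 : Ω → ℝ) ω ∂P :=
        (integral_finsetSum _ hint).symm
    _ ≤ ∫ _ω, (R + 1) ∂P := by
        refine integral_mono (integrable_finsetSum _ hint) (integrable_const _) fun ω => ?_
        refine le_trans (le_of_eq ?_) (card_startsAt_le (N := N) (δ := δ) (μ := μ) (x := (X · ω)) hR)
        rw [Finset.card_filter]
        push_cast
        exact Finset.sum_congr rfl fun τ _ => by simp [Set.indicator_apply]
    _ = R + 1 := by simp

/-- The union runs over the times τ, not over round numbers. By independence it is bounded by δ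
times the expected number of starts, so no conditioning on random start times is needed. -/
theorem failure_prob [IsProbabilityMeasure P] (hk : 2 ≤ k) (hδ : 0 < δ) (hX : ∀ j, Measurable (X j))
    (hind : iIndepFun X P) (hμ0 : ∀ i, 0 ≤ μ i) (hdist : ∀ j i, P.real {ω | X j ω = i} = μ i)
    {R : ℝ} (hR : 0 ≤ R) :
    P.real {ω | ¬ NoFailure N δ μ R (X · ω)} ≤ δ * (R + 1) := by
  have hsub : {ω | ¬ NoFailure N δ μ R (X · ω)} ⊆ ⋃ τ ∈ Finset.range N,
      ({ω | StartsAt N δ μ R (X · ω) τ} ∩ {ω | Overfull δ μ (N - τ) (X · ω) τ}) := by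
    intro ω hω
    simp only [NoFailure, Set.mem_ofPred_eq, not_forall, not_not] at hω
    obtain ⟨τ, hτ, hs, ho⟩ := hω
    simp only [Set.mem_iUnion]
    exact ⟨τ, Finset.mem_range.2 hτ, hs, ho⟩
  calc P.real {ω | ¬ NoFailure N δ μ R (X · ω)}
      ≤ _ := measureReal_mono hsub (measure_ne_top _ _)
    _ ≤ ∑ τ ∈ Finset.range N, P.real ({ω | StartsAt N δ μ R (X · ω) τ} ∩
          {ω | Overfull δ μ (N - τ) (X · ω) τ}) := measureReal_biUnion_finset_le _ _
    _ ≤ ∑ τ ∈ Finset.range N, P.real {ω | StartsAt N δ μ R (X · ω) τ} * δ := by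
        refine Finset.sum_le_sum fun τ _ => ?_
        rw [indep_starts_overfull hX hind]
        by_cases hthr : CustomThreshold k δ (N - τ)
        · gcongr
          exact overfull_prob hthr hk hX hind hμ0 hdist τ
        · have : {ω | StartsAt N δ μ R (X · ω) τ} = ∅ :=
            Set.eq_empty_of_forall_notMem fun ω h => hthr h.2.2.2
          simp [this]
    _ ≤ δ * (R + 1) := by
        rw [← Finset.sum_mul, mul_comm]
        gcongr
        exact sum_startsAt_le hX hR

lemma half_le_loglog {N : ℕ} (hN : 8 ≤ N) : 1 / 2 ≤ loglog N := by
  have h2 := Real.log_two_gt_d9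
  have hN' : (8 : ℝ) ≤ N := by exact_mod_cast hN
  have h1 : 2 ≤ Real.posLog N := by
    refine le_trans ?_ (le_max_right 0 _)
    have : Real.log 8 = 3 * Real.log 2 := by
      rw [show (8 : ℝ) = 2 ^ 3 by norm_num, Real.log_pow]; norm_num
    linarith [Real.log_le_log (by norm_num) hN']
  have h3 : Real.log 2 ≤ loglog N :=
    (Real.log_le_log (by norm_num) h1).trans (le_max_right 0 _)
  linarith

lemma loglog_mono {a b : ℝ} (ha : 0 ≤ a) (hab : a ≤ b) : loglog a ≤ loglog b :=
  Real.posLog_le_posLog Real.posLog_nonneg (Real.posLog_le_posLog ha hab)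

/-- For k ≥ 2 one has kL ≥ 1, so LL(N/(kL)) ≤ LL(N), and LL(N) ≥ 1/2 for N ≥ 8 absorbs the additive
constant. Otherwise a slack round of the plugged-in algorithm forces k = 1, where its quiet part is
shorter than t and cannot be overfull. -/
lemma failure_prob_le [IsProbabilityMeasure P] (hk : 1 ≤ k) (h0 : 0 < δ) (h1 : δ < 1) (hX : ∀ j, Measurable (X j))
    (hind : iIndepFun X P) (hμ0 : ∀ i, 0 ≤ μ i) (hμ1 : ∑ i, μ i = 1)
    (hdist : ∀ j i, P.real {ω | X j ω = i} = μ i) :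
    P.real {ω | ¬ NoFailure N δ μ (fastRounds k δ N) (X · ω)} ≤ 6 * δ * loglog N := by
  have hll := loglog_nonneg (N : ℝ)
  by_cases hbig : 2 ≤ k ∧ 8 ≤ N
  · have hf : 0 ≤ fastRounds k δ N := by
      have := loglog_nonneg (N / (k * Real.log (k / δ)))
      rw [fastRounds]; linarith
    refine (failure_prob hbig.1 h0 hX hind hμ0 hdist hf).trans ?_
    have hL := log_ge hbig.1 h0 h1
    have hk2 : (2 : ℝ) ≤ k := by exact_mod_cast hbig.1
    have hm : loglog (N / (k * Real.log (k / δ))) ≤ loglog N := by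
      apply loglog_mono (by positivity)
      apply div_le_self (by positivity)
      nlinarith
    have := half_le_loglog hbig.2
    have : fastRounds k δ N + 1 ≤ 6 * loglog N := by rw [fastRounds]; linarith
    calc δ * (fastRounds k δ N + 1) ≤ δ * (6 * loglog N) := by gcongr
      _ = 6 * δ * loglog N := by ring
  · have hempty : {ω | ¬ NoFailure N δ μ (fastRounds k δ N) (X · ω)} = ∅ := by
      refine Set.eq_empty_of_forall_notMem fun ω hω => hω fun τ _ hs => ?_
      have hthr := hs.2.2.2
      have := hthr.four_lt
      obtain rfl : k = 1 := by omega
      exact not_overfull_of_one_player hthr hμ1 _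
    rw [hempty]
    simp only [measureReal_empty]
    positivity

end Probability

end DistributedTracking

/-! ### The main theorem. -/

open MeasureTheory ProbabilityTheory DistributedTracking in
theorem mainTheorem3 :
    ∃ C : ℝ, 0 < C ∧
      ∀ (k N : ℕ) (μ : Fin k → ℝ) (δ : ℝ),
        (∀ i, 0 ≤ μ i) → ∑ i, μ i = 1 → 0 < δ → δ < 1 →
        ∀ (Ω : Type*) [MeasurableSpace Ω] (P : Measure Ω) [IsProbabilityMeasure P]
          (X : ℕ → Ω → Fin k),
          (∀ j, Measurable (X j)) → iIndepFun X P →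
          (∀ j i, P.real {ω | X j ω = i} = μ i) →
          1 - C * δ * loglog N ≤
            P.real {ω |
              -- the alarm is raised exactly at the arrival of the `N`-th item
              (∀ m, (dynSlkRun N δ μ (X · ω) m).mode = Mode.alarm ↔ N ≤ m) ∧
              ((dynSlkRun N δ μ (X · ω) N).rounds : ℝ) ≤
                C * (1 + loglog (N / (k * Real.log (k / δ))) + loglog (k / δ)) ∧
              ((dynSlkRun N δ μ (X · ω) N).msgs : ℝ) ≤
                C * (k * (1 + loglog (N / (k * Real.log (k / δ))) + loglog (k / δ)))} := by
  -- 415 = 5 · 83: at most 83·B rounds, where 83 = 82 + 1 comes from `slowBound_le` and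
  -- `potential_le`, and 5k messages per round.
  refine ⟨415, by norm_num, ?_⟩
  intro k N μ δ hμ0 hμ1 h0 h1 Ω _ P _ X hX hind hdist
  have hk : 1 ≤ k := by
    rcases Nat.eq_zero_or_pos k with rfl | h
    · simp at hμ1
    · exact h
  have hL := log_pos hk h0 h1
  have hfail := failure_prob_le (N := N) hk h0 h1 hX hind hμ0 hμ1 hdist
  set B := 1 + loglog (N / (k * Real.log (k / δ))) + loglog (k / δ) with hB
  have hlk : loglog (k / δ) = Real.posLog (Real.log (k / δ)) := by
    rw [loglog, Real.posLog_apply (x := k / δ), max_eq_right hL.le]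
  have hpot : potential k (Real.log (k / δ)) N ≤ 83 * B := by
    have e1 := potential_le (n := N) hk hL
    have e2 := slowBound_le hL
    have e3 := loglog_nonneg (N / (k * Real.log (k / δ)))
    have e4 := loglog_nonneg (k / δ)
    rw [← hlk] at e2
    rw [hB]
    linarith
  set G := {ω | (∀ m, (dynSlkRun N δ μ (X · ω) m).mode = Mode.alarm ↔ N ≤ m) ∧
    ((dynSlkRun N δ μ (X · ω) N).rounds : ℝ) ≤ 415 * B ∧
    ((dynSlkRun N δ μ (X · ω) N).msgs : ℝ) ≤ 415 * (k * B)} with hG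
  have hB0 : 0 ≤ B := by
    have e3 := loglog_nonneg (N / (k * Real.log (k / δ)))
    have e4 := loglog_nonneg (k / δ)
    rw [hB]; linarith
  have hcover : Set.univ ⊆ {ω | ¬ NoFailure N δ μ (fastRounds k δ N) (X · ω)} ∪ G := by
    intro ω _
    by_cases hω : NoFailure N δ μ (fastRounds k δ N) (X · ω)
    · right
      obtain ⟨ha, hr, hm⟩ := run_spec hk h0 h1 hμ0 hμ1 hω
      refine ⟨ha, by linarith, ?_⟩
      have hm' : ((dynSlkRun N δ μ (X · ω) N).msgs : ℝ) ≤
          5 * k * (dynSlkRun N δ μ (X · ω) N).rounds := by exact_mod_cast hm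
      calc ((dynSlkRun N δ μ (X · ω) N).msgs : ℝ)
          ≤ 5 * k * (dynSlkRun N δ μ (X · ω) N).rounds := hm'
        _ ≤ 5 * k * (83 * B) := by gcongr; exact hr.trans hpot
        _ = 415 * (k * B) := by ring
    · exact .inl hω
  have h2 := (measureReal_mono (μ := P) hcover).trans (measureReal_union_le _ _)
  rw [probReal_univ] at h2
  have h3 : 0 ≤ δ * loglog N := mul_nonneg h0.le (loglog_nonneg _)
  linarith
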